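/- Let $\mathbb{D}=\{|w|<1\}\subset\mathbb{C}$ and let $\mathbb{H}^2$ be the disk model of the hyperbolic plane, that is $\mathbb{D}$ with the metric $\sigma(z)^2|dz|^2$, $\sigma(z)=2/(1-|z|^2)$; give $\mathbb{H}^2\times\mathbb{R}$ the product metric. For a smooth conformal minimal immersion $X=(h,f):\mathbb{D}\to\mathbb{H}^2\times\mathbb{R}$ let $\phi\,dw^2$ be the Hopf differential of $h$, where $\phi=(\sigma\circ h)^2\,h_w\,\overline{h}_w$. Say that $X$ is an entire graph if it is a one-to-one parametrization of $\{(z,t): z\in\mathbb{H}^2,\ t=u(z)\}$ for some smooth function $u:\mathbb{H}^2\to\mathbb{R}$. A divergent path in $\mathbb{D}$ is a $C^1$ path $\gamma:[0,1)\to\mathbb{D}$ that eventually leaves every compact subset of $\mathbb{D}$. Two conformal minimal immersions $X=(h,f)$ and $X^*=(h^*,f^*)$ of $\mathbb{D}$ into $\mathbb{H}^2\times\mathbb{R}$ are conjugate if they induce the same metric on $\mathbb{D}$ and their Hopf differentials are opposite, $\phi^*=-\phi$. **Theorem.** Let $X=(h,f):\mathbb{D}\to\mathbb{H}^2\times\mathbb{R}$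 be a conformal minimal immersion that is an entire graph. Suppose that $$\int_\gamma|\phi|^{1/2}\,|dw|=\int_0^1|\phi(\gamma(t))|^{1/2}\,|\gamma'(t)|\,dt<\infty$$ for every divergent path $\gamma$ in $\mathbb{D}$ of finite Euclidean length. Then every conformal minimal immersion $X^*:\mathbb{D}\to\mathbb{H}^2\times\mathbb{R}$ conjugate to $X$ is an entire graph. -/

import Mathlib

open Set Filter Topology MeasureTheory
open scoped ContDiff ComplexConjugate

noncomputable section

/-- The open unit disk of `ℂ`. It is the parameter domain of the surfaces and, with the metric
`σ² |dz|²` below, also the model of the hyperbolic plane `ℍ²`. -/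
def disk : Set ℂ := Metric.ball (0 : ℂ) 1

/-- The conformal factor of the hyperbolic metric `σ(z)² |dz|²` of curvature `-1` on the disk. -/
def hypFactor (z : ℂ) : ℝ := 2 / (1 - ‖z‖ ^ 2)

/-- The Wirtinger derivative `∂F/∂w = (F_u - i F_v) / 2`, where `w = u + i v`. -/
def wirt (F : ℂ → ℂ) (w : ℂ) : ℂ :=
  (fderiv ℝ F w 1 - Complex.I * fderiv ℝ F w Complex.I) / 2

/-- The Wirtinger derivative `∂F/∂w̄ = (F_u + i F_v) / 2`, where `w = u + i v`. -/
def wirtBar (F : ℂ → ℂ) (w : ℂ) : ℂ :=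
  (fderiv ℝ F w 1 + Complex.I * fderiv ℝ F w Complex.I) / 2

/-- The harmonic map equation for `h : disk → ℍ²`:
`h_{w w̄} + 2 ((log σ)_z ∘ h) h_w h_w̄ = 0`. -/
def IsHarmonicMap (h : ℂ → ℂ) : Prop :=
  ∀ w ∈ disk,
    wirtBar (wirt h) w
      + 2 * wirt (fun z => ((Real.log (hypFactor z) : ℝ) : ℂ)) (h w) * wirt h w * wirtBar h w = 0

/-- The first fundamental form of `X = (h, f)` at `w`: the pull-back by `X` of the product metric
`σ² |dz|² + dt²` of `ℍ² × ℝ`. -/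
def firstForm (h : ℂ → ℂ) (f : ℂ → ℝ) (w v₁ v₂ : ℂ) : ℝ :=
  hypFactor (h w) ^ 2 * inner ℝ (fderiv ℝ h w v₁) (fderiv ℝ h w v₂)
    + fderiv ℝ f w v₁ * fderiv ℝ f w v₂

/-- `X = (h, f)` restricts to a smooth conformal minimal immersion `disk → ℍ² × ℝ`: its first
fundamental form is a positive multiple of the Euclidean metric, and `X` is harmonic (for a
conformal immersion this is the vanishing of the mean curvature vector). Values outside the disk
are irrelevant. -/
structure IsConformalMinimalImmersion (h : ℂ → ℂ) (f : ℂ → ℝ) : Prop where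
  mapsTo : MapsTo h disk disk
  smooth_fst : ContDiffOn ℝ ∞ h disk
  smooth_snd : ContDiffOn ℝ ∞ f disk
  conformal : ∀ w ∈ disk, ∃ l : ℝ, 0 < l ∧
    ∀ v₁ v₂ : ℂ, firstForm h f w v₁ v₂ = l ^ 2 * inner ℝ v₁ v₂
  harmonic_fst : IsHarmonicMap h
  harmonic_snd : InnerProductSpace.HarmonicOnNhd f disk

/-- `G` is the vertical graph in `ℍ² × ℝ` of a smooth function on `U`. -/
def IsVerticalGraph (G : Set (ℂ × ℝ)) (U : Set ℂ) : Prop :=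
  ∃ u : ℂ → ℝ, ContDiffOn ℝ ∞ u U ∧ G = {p : ℂ × ℝ | p.1 ∈ U ∧ p.2 = u p.1}

/-- `X = (h, f)`, restricted to the disk, is a one-to-one parametrization of an entire vertical
graph, that is of the graph of a smooth function on the whole of `ℍ²`. -/
def IsEntireGraph (h : ℂ → ℂ) (f : ℂ → ℝ) : Prop :=
  InjOn (fun w => (h w, f w)) disk ∧ IsVerticalGraph ((fun w => (h w, f w)) '' disk) disk

/-- The coefficient `φ = (σ ∘ h)² h_w (h̄)_w` of the Hopf differential `Q(h) = φ dw²`. -/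
def hopf (h : ℂ → ℂ) (w : ℂ) : ℂ :=
  (hypFactor (h w) : ℂ) ^ 2 * wirt h w * wirt (fun z => conj (h z)) w

/-- `(h, f)` and `(h', f')` are conjugate: they induce the same metric on the disk and
`Q(h') = - Q(h)`. -/
def IsConjugate (h : ℂ → ℂ) (f : ℂ → ℝ) (h' : ℂ → ℂ) (f' : ℂ → ℝ) : Prop :=
  (∀ w ∈ disk, ∀ v₁ v₂ : ℂ, firstForm h' f' w v₁ v₂ = firstForm h f w v₁ v₂) ∧
    ∀ w ∈ disk, hopf h' w = - hopf h w

/-- `γ : [0, 1) → disk` is a `C¹` path that eventually leaves every compact subset of the disk. -/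
structure IsDivergentPath (γ : ℝ → ℂ) : Prop where
  contDiffOn : ContDiffOn ℝ 1 γ (Ico 0 1)
  mapsTo : MapsTo γ (Ico 0 1) disk
  leaves : ∀ K : Set ℂ, IsCompact K → K ⊆ disk → ∀ᶠ t in 𝓝[<] (1 : ℝ), γ t ∉ K

/-- The path `γ` on `[0, 1)` has finite Euclidean length. -/
def HasFiniteLength (γ : ℝ → ℂ) : Prop :=
  IntegrableOn (fun t => ‖deriv γ t‖) (Ico 0 1)

end

/-! Put p = |h_w| and q = |h_w̄|. From the Euclidean to the hyperbolic metric, the singular values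
of dh are σ(h)(p + q) and σ(h)|p - q|. Conformality makes σ(h)(p + q) the conformal factor of the
induced metric, while σ(h)²pq = |φ|. Conjugate immersions share both quantities, hence also the
smaller singular value (`conjugate_norm_sub`). So it is enough to show σ(h)|p - q| ≥ c σ(w) for the
given graph: then h' expands the hyperbolic metric by a definite factor, so paths lift and h' is a
diffeomorphism of the disk (`bijOn_disk_of_expanding`), which makes X' an entire graph.

The lower bound near the circle has two sources. First, h is a harmonic diffeomorphism of the disk,
and the maximum principle for log of σ(w)²/(σ(h)²p²) gives σ(h) max(p, q) ≥ σ(w)/√6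
(`harmonic_expanding_bound`, `harmonic_diffeo_expanding_bound`). Second, f = Re F with F holomorphic
and |φ| = |F'|²/4. Integrability of |φ|^(1/2) along finite-length divergent paths forces |F'(w)|(1 -
|w|) → 0 at the circle: otherwise a finite-length path could be threaded through pairs of points
between which F oscillates by a fixed amount (`little_bloch_of_integrable_along_paths`). Hence |φ| ≤
σ(w)²/16 near the circle, so the smaller of σ(h)p, σ(h)q is too small to cancel the larger. On the
remaining compact disk the smaller singular value is positive because h is a local diffeomorphism
(`exists_expanding_factor`). -/

/-! ### Wirtinger calculus. -/

/-- The real-linear map `v ↦ p v + q v̄` of `ℂ`. -/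
noncomputable def wirtCLM (p q : ℂ) : ℂ →L[ℝ] ℂ :=
  p • ContinuousLinearMap.id ℝ ℂ + q • (Complex.conjCLE : ℂ →L[ℝ] ℂ)

@[simp] theorem wirtCLM_apply (p q v : ℂ) : wirtCLM p q v = p * v + q * conj v := by
  simp [wirtCLM]

/-- `F` is real differentiable at `w` with Wirtinger derivatives `F_w = p` and `F_w̄ = q`. -/
def HasWirt (F : ℂ → ℂ) (p q w : ℂ) : Prop := HasFDerivAt F (wirtCLM p q) w

theorem clm_eq_wirtCLM (L : ℂ →L[ℝ] ℂ) :
    L = wirtCLM ((L 1 - Complex.I * L Complex.I) / 2) ((L 1 + Complex.I * L Complex.I) / 2) := by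
  ext v
  have hv : v = v.re • (1 : ℂ) + v.im • Complex.I := by
    simp [Complex.re_add_im]
  have h1 : L v = v.re * L 1 + v.im * L Complex.I := by
    conv_lhs => rw [hv]
    rw [map_add, map_smul, map_smul]; simp
  have h2 : v = v.re + v.im * Complex.I := (Complex.re_add_im v).symm
  have h3 : conj v = v.re - v.im * Complex.I := by
    apply Complex.ext <;> simp
  rw [h1, wirtCLM_apply, h3]
  linear_combination (-(L 1 - Complex.I * L Complex.I) / 2) * h2 +
    (v.im * L Complex.I) * Complex.I_sq

theorem fderiv_eq_wirtCLM (F : ℂ → ℂ) (w : ℂ) :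
    fderiv ℝ F w = wirtCLM (wirt F w) (wirtBar F w) := clm_eq_wirtCLM _

theorem fderiv_apply_wirt (F : ℂ → ℂ) (w v : ℂ) :
    fderiv ℝ F w v = wirt F w * v + wirtBar F w * conj v := by
  rw [fderiv_eq_wirtCLM, wirtCLM_apply]

theorem DifferentiableAt.hasWirt {F : ℂ → ℂ} {w : ℂ} (hF : DifferentiableAt ℝ F w) :
    HasWirt F (wirt F w) (wirtBar F w) w := by
  have := hF.hasFDerivAt
  rwa [fderiv_eq_wirtCLM] at this

namespace HasWirt

variable {F G : ℂ → ℂ} {p q p' q' w : ℂ}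

theorem wirt_eq (hF : HasWirt F p q w) : wirt F w = p := by
  have := HasFDerivAt.fderiv hF
  simp only [wirt, this, wirtCLM_apply]
  simp
  linear_combination (-p / 2 + q / 2) * Complex.I_sq

theorem wirtBar_eq (hF : HasWirt F p q w) : wirtBar F w = q := by
  have := HasFDerivAt.fderiv hF
  simp only [wirtBar, this, wirtCLM_apply]
  simp
  linear_combination (p / 2 - q / 2) * Complex.I_sq

theorem differentiableAt (hF : HasWirt F p q w) : DifferentiableAt ℝ F w :=
  HasFDerivAt.differentiableAt hF

theorem congr_val (hF : HasWirt F p q w) (hp : p = p') (hq : q = q') : HasWirt F p' q' w := by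
  subst hp hq; exact hF

theorem congr (hF : HasWirt F p q w) (h : G =ᶠ[𝓝 w] F) : HasWirt G p q w :=
  HasFDerivAt.congr_of_eventuallyEq hF h

theorem const (c w : ℂ) : HasWirt (fun _ => c) 0 0 w := by
  have := hasFDerivAt_const (𝕜 := ℝ) c w
  refine this.congr_fderiv ?_
  ext v; simp

theorem id (w : ℂ) : HasWirt (fun z => z) 1 0 w := by
  have := hasFDerivAt_id (𝕜 := ℝ) w
  refine this.congr_fderiv ?_
  ext v; simp

theorem star (hF : HasWirt F p q w) :
    HasWirt (fun z => conj (F z)) (starRingEnd ℂ q) (starRingEnd ℂ p) w := by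
  have := (Complex.conjCLE : ℂ →L[ℝ] ℂ).hasFDerivAt.comp w hF
  refine this.congr_fderiv ?_
  ext v; simp; ring

theorem add (hF : HasWirt F p q w) (hG : HasWirt G p' q' w) :
    HasWirt (fun z => F z + G z) (p + p') (q + q') w := by
  refine (HasFDerivAt.add hF hG).congr_fderiv ?_
  ext v; simp; ring

theorem sub (hF : HasWirt F p q w) (hG : HasWirt G p' q' w) :
    HasWirt (fun z => F z - G z) (p - p') (q - q') w := by
  refine (HasFDerivAt.sub hF hG).congr_fderiv ?_
  ext v; simp; ring

theorem mul (hF : HasWirt F p q w) (hG : HasWirt G p' q' w) :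
    HasWirt (fun z => F z * G z) (p * G w + F w * p') (q * G w + F w * q') w := by
  refine (HasFDerivAt.mul hF hG).congr_fderiv ?_
  ext v; simp; ring

theorem inv (hF : HasWirt F p q w) (h0 : F w ≠ 0) :
    HasWirt (fun z => (F z)⁻¹) (-p / F w ^ 2) (-q / F w ^ 2) w := by
  have h1 := ((hasDerivAt_inv h0).hasFDerivAt.restrictScalars ℝ).comp w hF
  refine h1.congr_fderiv ?_
  ext v; simp; ring

theorem div (hF : HasWirt F p q w) (hG : HasWirt G p' q' w) (h0 : G w ≠ 0) :
    HasWirt (fun z => F z / G z) ((p * G w - F w * p') / G w ^ 2)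
      ((q * G w - F w * q') / G w ^ 2) w := by
  have := hF.mul (hG.inv h0)
  simp only [← div_eq_mul_inv] at this
  refine this.congr_val ?_ ?_ <;> field_simp <;> ring

theorem comp {a b : ℂ} (hG : HasWirt G a b (F w)) (hF : HasWirt F p q w) :
    HasWirt (fun z => G (F z)) (a * p + b * (starRingEnd ℂ) q)
      (a * q + b * (starRingEnd ℂ) p) w := by
  refine (HasFDerivAt.comp w hG hF).congr_fderiv ?_
  ext v; simp; ring

theorem log {u : ℂ → ℝ} (hu : HasWirt (fun z => (u z : ℂ)) p q w) (h0 : u w ≠ 0) :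
    HasWirt (fun z => (Real.log (u z) : ℂ)) (p / u w) (q / u w) w := by
  have h1 : HasFDerivAt u (Complex.reCLM.comp (wirtCLM p q)) w := by
    have := Complex.reCLM.hasFDerivAt.comp w hu
    simpa [Function.comp_def] using this
  have h2 := (Complex.ofRealCLM.hasFDerivAt.comp w h1)
  have h4 : Complex.ofRealCLM.comp (Complex.reCLM.comp (wirtCLM p q)) = wirtCLM p q :=
    HasFDerivAt.unique h2 hu
  have h3 := Complex.ofRealCLM.hasFDerivAt.comp w (h1.log h0)
  refine h3.congr_fderiv ?_
  ext v
  have h5 := congrArg (fun L : ℂ →L[ℝ] ℂ => L v) h4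
  simp only [ContinuousLinearMap.comp_apply, wirtCLM_apply, Complex.ofRealCLM_apply,
    Complex.reCLM_apply] at h5
  simp only [ContinuousLinearMap.comp_apply, smul_apply, wirtCLM_apply,
    Complex.ofRealCLM_apply, Complex.reCLM_apply, smul_eq_mul, Complex.ofReal_mul, h5]
  push_cast; ring

end HasWirt

theorem isOpen_disk : IsOpen disk := Metric.isOpen_ball

theorem mem_disk {z : ℂ} : z ∈ disk ↔ ‖z‖ < 1 := by simp [disk]

theorem wirt_contDiffAt {F : ℂ → ℂ} {w : ℂ} (hF : ContDiffAt ℝ ∞ F w) :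
    ContDiffAt ℝ ∞ (wirt F) w := by
  have h1 : ContDiffAt ℝ ∞ (fderiv ℝ F) w := hF.fderiv_right (by simp)
  unfold wirt
  have h2 (v : ℂ) : ContDiffAt ℝ ∞ (fun z => fderiv ℝ F z v) w := h1.clm_apply contDiffAt_const
  exact ((h2 1).sub (contDiffAt_const.mul (h2 _))).div_const 2

theorem wirtBar_contDiffAt {F : ℂ → ℂ} {w : ℂ} (hF : ContDiffAt ℝ ∞ F w) :
    ContDiffAt ℝ ∞ (wirtBar F) w := by
  have h1 : ContDiffAt ℝ ∞ (fderiv ℝ F) w := hF.fderiv_right (by simp)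
  unfold wirtBar
  have h2 (v : ℂ) : ContDiffAt ℝ ∞ (fun z => fderiv ℝ F z v) w := h1.clm_apply contDiffAt_const
  exact ((h2 1).add (contDiffAt_const.mul (h2 _))).div_const 2

theorem two_le_infty : (2 : WithTop ℕ∞) ≤ ∞ := WithTop.coe_le_coe.2 (le_top : (2 : ℕ∞) ≤ ⊤)

theorem wirt_wirtBar_comm {F : ℂ → ℂ} {w : ℂ} (hF : ContDiffAt ℝ ∞ F w) :
    wirt (wirtBar F) w = wirtBar (wirt F) w := by
  have hd : DifferentiableAt ℝ (fderiv ℝ F) w :=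
    (hF.fderiv_right (m := ∞) (by simp)).differentiableAt (by simp)
  have hsymm : fderiv ℝ (fderiv ℝ F) w 1 Complex.I = fderiv ℝ (fderiv ℝ F) w Complex.I 1 :=
    ((hF.of_le (m := 2) two_le_infty).isSymmSndFDerivAt (by simp)) 1 Complex.I
  have h1 (v : ℂ) : HasFDerivAt (fun z => fderiv ℝ F z v) ((fderiv ℝ (fderiv ℝ F) w).flip v) w :=
    hd.hasFDerivAt.clm_apply (hasFDerivAt_const v w) |>.congr_fderiv (by ext; simp)
  have h2 : HasFDerivAt (wirtBar F) _ w :=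
    (((h1 1).add ((h1 Complex.I).const_mul Complex.I)).mul_const (2⁻¹ : ℂ)).congr_of_eventuallyEq
      (.of_forall fun z => div_eq_mul_inv _ _)
  have h3 : HasFDerivAt (wirt F) _ w :=
    (((h1 1).sub ((h1 Complex.I).const_mul Complex.I)).mul_const (2⁻¹ : ℂ)).congr_of_eventuallyEq
      (.of_forall fun z => div_eq_mul_inv _ _)
  change (fderiv ℝ (wirtBar F) w 1 - Complex.I * fderiv ℝ (wirtBar F) w Complex.I) / 2 =
    (fderiv ℝ (wirt F) w 1 + Complex.I * fderiv ℝ (wirt F) w Complex.I) / 2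
  rw [h2.fderiv, h3.fderiv]
  simp [hsymm]
  ring

/-! ### Second-order conditions at a maximum. -/

/-- Second derivative test in one variable. -/
theorem IsLocalMax.deriv_deriv_nonpos {φ ψ : ℝ → ℝ} {x d : ℝ} (hm : IsLocalMax φ x)
    (h1 : ∀ᶠ y in 𝓝 x, HasDerivAt φ (ψ y) y) (h2 : HasDerivAt ψ d x) : d ≤ 0 := by
  by_contra! hd
  have h0 : ψ x = 0 := hm.hasDerivAt_eq_zero h1.self_of_nhds
  have he : deriv φ =ᶠ[𝓝 x] ψ := h1.mono fun y hy => hy.deriv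
  have hdd : deriv (deriv φ) x = d := by rw [he.deriv_eq]; exact h2.deriv
  -- If d > 0 the point is also a local minimum, so φ is locally constant, which forces d = 0.
  have hmin := isLocalMin_of_deriv_deriv_pos (by rw [hdd]; exact hd)
    (by rw [h1.self_of_nhds.deriv, h0]) h1.self_of_nhds.continuousAt
  have hc : φ =ᶠ[𝓝 x] fun _ => φ x := by
    filter_upwards [hm, hmin] with y h3 h4 using le_antisymm h3 h4
  have h5 : deriv φ =ᶠ[𝓝 x] fun _ => 0 := by
    have := hc.deriv
    simpa using this
  rw [h5.deriv_eq] at hdd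
  simp at hdd
  linarith

/-- At a local maximum of a real function with `u_w = Q`, the real part of `Q_w̄` is not positive. -/
theorem IsLocalMax.re_laplacian_nonpos {u : ℂ → ℝ} {Q : ℂ → ℂ} {s t w : ℂ}
    (hm : IsLocalMax u w)
    (h1 : ∀ᶠ z in 𝓝 w, HasWirt (fun z => (u z : ℂ)) (Q z) (conj (Q z)) z)
    (h2 : HasWirt Q s t w) : t.re ≤ 0 := by
  have key (e : ℂ) : 2 * ((s * e + t * conj e) * e).re ≤ 0 := by
    have hline (x : ℝ) : HasDerivAt (fun x : ℝ => w + x * e) e x := by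
      simpa using ((Complex.ofRealCLM.hasDerivAt (x := x)).mul_const e).const_add w
    have hcont : Tendsto (fun x : ℝ => w + x * e) (𝓝 0) (𝓝 w) := by
      have := (hline 0).continuousAt.tendsto
      simpa using this
    refine IsLocalMax.deriv_deriv_nonpos (φ := fun x : ℝ => u (w + x * e))
      (ψ := fun x : ℝ => 2 * (Q (w + x * e) * e).re) (x := 0) ?_ ?_ ?_
    · have := hcont.eventually hm
      simpa [IsLocalMax, IsMaxFilter] using this
    · filter_upwards [hcont.eventually h1] with x hx
      have h3 := (Complex.reCLM.hasFDerivAt.comp (w + x * e) hx).comp_hasDerivAt x (hline x)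
      simp only [Function.comp_def, Complex.reCLM_apply, Complex.ofReal_re] at h3
      refine h3.congr_deriv ?_
      simp; ring
    · have h2' : HasWirt Q s t (w + (0 : ℝ) * e) := by simpa using h2
      have h3 := HasFDerivAt.comp_hasDerivAt (f := fun x : ℝ => w + x * e) (0 : ℝ) h2' (hline 0)
      have h4 := (Complex.reCLM.hasFDerivAt.comp_hasDerivAt (0 : ℝ) (h3.mul_const e)).const_mul 2
      simpa [Function.comp_def] using h4
  -- The contributions of s in the directions 1 and i cancel; what remains is 4 Re t, the Laplacian.
  have k1 := key 1
  have k2 := key Complex.I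
  simp at k1 k2
  linarith

theorem HasWirt.real_conj {u : ℂ → ℝ} {p q w : ℂ} (hu : HasWirt (fun z => (u z : ℂ)) p q w) :
    q = conj p := by
  have := hu.star
  simp only [Complex.conj_ofReal] at this
  rw [← hu.wirtBar_eq, this.wirtBar_eq]

/-! ### The hyperbolic density and its connection coefficient. -/

/-- The function `1 - |z|²`. -/
noncomputable def diskGap (z : ℂ) : ℝ := 1 - ‖z‖ ^ 2

theorem ofReal_diskGap (z : ℂ) : (diskGap z : ℂ) = 1 - z * conj z := by
  rw [Complex.mul_conj', diskGap]; push_cast; ring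

theorem diskGap_pos {z : ℂ} (hz : z ∈ disk) : 0 < diskGap z := by
  rw [mem_disk] at hz
  unfold diskGap
  nlinarith [norm_nonneg z]

theorem diskGap_le_one (z : ℂ) : diskGap z ≤ 1 := by
  unfold diskGap; nlinarith [norm_nonneg z]

theorem hypFactor_eq (z : ℂ) : hypFactor z = 2 / diskGap z := rfl

theorem continuous_diskGap : Continuous diskGap := by unfold diskGap; fun_prop

theorem hasWirt_diskGap (z : ℂ) : HasWirt (fun z => (diskGap z : ℂ)) (-conj z) (-z) z := by
  simp only [ofReal_diskGap]
  refine ((HasWirt.const 1 z).sub ((HasWirt.id z).mul (HasWirt.id z).star)).congr_val ?_ ?_ <;> simp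

theorem HasWirt.diskGap_comp {h : ℂ → ℂ} {p b w : ℂ} (hh : HasWirt h p b w) :
    HasWirt (fun z => (diskGap (h z) : ℂ)) (-conj (h w) * p - h w * conj b)
      (-conj (h w) * b - h w * conj p) w :=
  ((hasWirt_diskGap (h w)).comp hh).congr_val (by ring) (by ring)

/-- The coefficient `(log σ)_z = z̄ / (1 - |z|²)`. -/
noncomputable def diskConn (z : ℂ) : ℂ := conj z / diskGap z

theorem hasWirt_diskConn {z : ℂ} (hz : z ∈ disk) :
    HasWirt diskConn (diskConn z ^ 2) (1 / diskGap z ^ 2) z := by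
  have h0 : (diskGap z : ℂ) ≠ 0 := by exact_mod_cast (diskGap_pos hz).ne'
  refine ((HasWirt.id z).star.div (hasWirt_diskGap z) h0).congr_val ?_ ?_
  · simp [diskConn]; field_simp
  · simp only [map_one, one_mul]
    rw [ofReal_diskGap]; ring_nf

theorem wirt_log_hypFactor {z : ℂ} (hz : z ∈ disk) :
    wirt (fun z => ((Real.log (hypFactor z) : ℝ) : ℂ)) z = diskConn z := by
  have h0 := (diskGap_pos hz).ne'
  have h1 := (HasWirt.const (Real.log 2 : ℂ) z).sub ((hasWirt_diskGap z).log h0)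
  refine (h1.congr ?_).wirt_eq.trans ?_
  · filter_upwards [isOpen_disk.mem_nhds hz] with y hy
    rw [hypFactor_eq, Real.log_div two_ne_zero (diskGap_pos hy).ne']
    push_cast; rfl
  · simp [diskConn, neg_div]

/-! ### Maximum principle for harmonic maps into the hyperbolic disk. -/

section Bound

variable {h : ℂ → ℂ} {w : ℂ}

/-- The harmonic map equation reads (h_w)_w̄ = r h_w with r = -2 (log σ)_z(h) h_w̄, so r is the
w̄-derivative of log h_w. Its w-derivative is therefore what enters the Laplacian of log |h_w|². -/
theorem hasWirt_connection_term (hw : h w ∈ disk) (hs : ContDiffAt ℝ ∞ h w)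
    (hh : wirtBar (wirt h) w = -2 * diskConn (h w) * wirt h w * wirtBar h w) :
    ∃ q, HasWirt (fun z => -2 * diskConn (h z) * wirtBar h z)
      (2 * diskConn (h w) ^ 2 * wirt h w * wirtBar h w
        - 2 * (wirtBar h w * conj (wirtBar h w)) / diskGap (h w) ^ 2) q w := by
  have h1 := (hs.differentiableAt (by simp)).hasWirt
  have h2 := ((wirtBar_contDiffAt hs).differentiableAt (by simp)).hasWirt
  have h3 := ((HasWirt.const (-2) w).mul ((hasWirt_diskConn hw).comp h1)).mul h2
  refine ⟨_, h3.congr_val ?_ rfl⟩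
  rw [wirt_wirtBar_comm hs, hh]
  ring

/-- The derivative `∂/∂w` of the logarithm of `(1 - |h|² - ε)² / ((1 - |w|²)² |h_w|²)`. -/
noncomputable def logQuotWirt (h : ℂ → ℂ) (ε : ℝ) (z : ℂ) : ℂ :=
  2 * ((-(conj (h z) * wirt h z) - h z * conj (wirtBar h z)) / (diskGap (h z) - ε))
    + 2 * diskConn z - (wirt (wirt h) z / wirt h z
      + conj (-2 * diskConn (h z) * wirtBar h z))

theorem hasWirt_logQuot {ε : ℝ} (hw : w ∈ disk) (hs : ContDiffAt ℝ ∞ h w)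
    (hh : wirtBar (wirt h) w = -2 * diskConn (h w) * wirt h w * wirtBar h w)
    (hp : wirt h w ≠ 0) (hε : ε < diskGap (h w)) :
    HasWirt (fun z => ((2 * Real.log (diskGap (h z) - ε) - 2 * Real.log (diskGap z)
        - Real.log (‖wirt h z‖ ^ 2) : ℝ) : ℂ)) (logQuotWirt h ε w) (conj (logQuotWirt h ε w)) w := by
  -- For a real function the w̄-derivative is the conjugate of the w-derivative, so only the latter
  -- is computed.
  suffices H : ∃ q, HasWirt (fun z => ((2 * Real.log (diskGap (h z) - ε) - 2 * Real.log (diskGap z)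
        - Real.log (‖wirt h z‖ ^ 2) : ℝ) : ℂ)) (logQuotWirt h ε w) q w by
    obtain ⟨q, hq⟩ := H
    rwa [hq.real_conj] at hq
  have h1 := (hs.differentiableAt (by simp)).hasWirt
  have h2 := ((wirt_contDiffAt hs).differentiableAt (by simp)).hasWirt
  have e1 : HasWirt (fun z => ((diskGap (h z) - ε : ℝ) : ℂ)) _ _ w :=
    (h1.diskGap_comp.sub (HasWirt.const (ε : ℂ) w)).congr (.of_forall fun z => by push_cast; rfl)
  have e2 : HasWirt (fun z => ((‖wirt h z‖ ^ 2 : ℝ) : ℂ)) _ _ w :=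
    (h2.mul h2.star).congr (.of_forall fun z => by
      simp only [Complex.mul_conj']; push_cast; rfl)
  have f1 := (HasWirt.const 2 w).mul (e1.log (sub_pos.2 hε).ne')
  have f2 := (HasWirt.const 2 w).mul ((hasWirt_diskGap w).log (diskGap_pos hw).ne')
  have f3 := e2.log (by positivity)
  refine ⟨_, (((f1.sub f2).sub f3).congr (.of_forall fun z => by push_cast; rfl)).congr_val ?_ rfl⟩
  have hp' : conj (wirt h w) ≠ 0 := by simpa using hp
  have hp2 : ((‖wirt h w‖ ^ 2 : ℝ) : ℂ) = wirt h w * conj (wirt h w) := by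
    rw [Complex.mul_conj']; push_cast; rfl
  have hZ : (diskGap (h w) - ε : ℂ) ≠ 0 := by exact_mod_cast (sub_pos.2 hε).ne'
  have hg : (diskGap w : ℂ) ≠ 0 := by exact_mod_cast (diskGap_pos hw).ne'
  have key : (wirt (wirt h) w * conj (wirt h w) + wirt h w * conj (wirtBar (wirt h) w))
      / ((‖wirt h w‖ ^ 2 : ℝ) : ℂ) = wirt (wirt h) w / wirt h w
      + conj (-2 * diskConn (h w) * wirtBar h w) := by
    rw [hp2, hh]
    field_simp
    simp only [map_mul, map_neg, map_ofNat]
    ring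
  rw [key]
  simp only [logQuotWirt, diskConn, zero_mul, zero_add, sub_zero]
  push_cast
  ring

/-- The w̄-derivative found here is a quarter of the Laplacian of the log quotient. Commuting
derivatives gives h_www̄ = r_w h_w + r h_ww, with r the connection term, so the quotient h_ww / h_w
has w̄-derivative r_w and no third derivative of h survives. -/
theorem hasWirt_logQuotWirt {ε : ℝ} (hw : w ∈ disk) (hhw : h w ∈ disk) (hs : ContDiffAt ℝ ∞ h w)
    (hh : ∀ᶠ z in 𝓝 w,
      wirtBar (wirt h) z = -2 * diskConn (h z) * wirt h z * wirtBar h z)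
    (hp : wirt h w ≠ 0) (hε : ε < diskGap (h w)) :
    let S := ‖wirt h w‖ ^ 2 + ‖wirtBar h w‖ ^ 2
    let T := (diskConn (h w) ^ 2 * wirt h w * wirtBar h w).re
    let Y := diskGap (h w)
    ∃ s, HasWirt (logQuotWirt h ε) s
      ((2 * ((-S + 4 * Y * T) * (Y - ε) - ((1 - Y) * S + 2 * Y ^ 2 * T)) / (Y - ε) ^ 2
        + 2 / diskGap w ^ 2 - 4 * T + 4 * ‖wirtBar h w‖ ^ 2 / Y ^ 2 : ℝ) : ℂ) w := by
  intro S T Y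
  have h1 := (hs.differentiableAt (by simp)).hasWirt
  have hsp := wirt_contDiffAt hs
  have h2 := (hsp.differentiableAt (by simp)).hasWirt
  have h3 := ((wirtBar_contDiffAt hs).differentiableAt (by simp)).hasWirt
  have h4 := ((wirt_contDiffAt hsp).differentiableAt (by simp)).hasWirt
  obtain ⟨q, hr⟩ := hasWirt_connection_term hhw hs hh.self_of_nhds
  have hpwb : wirtBar (wirt (wirt h)) w =
      (2 * diskConn (h w) ^ 2 * wirt h w * wirtBar h w
        - 2 * (wirtBar h w * conj (wirtBar h w)) / diskGap (h w) ^ 2) * wirt h w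
      + (-2 * diskConn (h w) * wirtBar h w) * wirt (wirt h) w := by
    rw [← wirt_wirtBar_comm hsp]
    refine ((hr.mul h2).congr ?_).wirt_eq
    filter_upwards [hh] with z hz
    rw [hz]; ring
  have hZ : (diskGap (h w) - ε : ℂ) ≠ 0 := by exact_mod_cast (sub_pos.2 hε).ne'
  have hY : (diskGap (h w) : ℂ) ≠ 0 := by exact_mod_cast (diskGap_pos hhw).ne'
  have hg : (diskGap w : ℂ) ≠ 0 := by exact_mod_cast (diskGap_pos hw).ne'
  have d1 := ((HasWirt.const 0 w).sub (h1.star.mul h2)).sub (h1.mul h3.star)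
  have d2 := d1.div (h1.diskGap_comp.sub (HasWirt.const (ε : ℂ) w)) hZ
  have d3 := (((HasWirt.const 2 w).mul d2).add
    ((HasWirt.const 2 w).mul (hasWirt_diskConn hw))).sub ((h4.div h2 hp).add hr.star)
  refine ⟨_, (d3.congr (.of_forall fun z => ?_)).congr_val rfl ?_⟩
  · simp only [logQuotWirt, zero_sub]
  · have hT : (T : ℂ) = (diskConn (h w) ^ 2 * wirt h w * wirtBar h w
        + conj (diskConn (h w) ^ 2 * wirt h w * wirtBar h w)) / 2 := Complex.re_eq_add_conj _
    have hS : (S : ℂ) = wirt h w * conj (wirt h w) + wirtBar h w * conj (wirtBar h w) := by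
      rw [Complex.mul_conj', Complex.mul_conj']; simp [S]
    have hB : ((‖wirtBar h w‖ ^ 2 : ℝ) : ℂ) = wirtBar h w * conj (wirtBar h w) := by
      rw [Complex.mul_conj']; push_cast; rfl
    have hA : conj (h w) = diskConn (h w) * Y := by
      simp only [diskConn, Y]; field_simp
    have hA' : h w = conj (diskConn (h w)) * Y := by
      have := congrArg conj hA; simpa using this
    have hYY : (Y : ℂ) = 1 - h w * conj (h w) := ofReal_diskGap _
    have hq : (wirtBar (wirt (wirt h)) w * wirt h w - wirt (wirt h) w * wirtBar (wirt h) w)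
        / wirt h w ^ 2 = 2 * diskConn (h w) ^ 2 * wirt h w * wirtBar h w
        - 2 * (wirtBar h w * conj (wirtBar h w)) / diskGap (h w) ^ 2 := by
      rw [hpwb, hh.self_of_nhds]
      rw [div_eq_iff (pow_ne_zero 2 hp)]
      ring
    rw [hq, wirt_wirtBar_comm hs, hh.self_of_nhds]
    push_cast at hB ⊢
    rw [hB, hS, hT]
    simp only [map_mul, map_sub, map_neg, map_pow, map_div₀, map_ofNat, Complex.conj_conj,
      Complex.conj_ofReal, zero_mul, zero_sub, zero_add, sub_zero]
    simp only [map_mul, map_pow] at hT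
    change (diskGap (h w) : ℂ) = _ at hYY
    simp only [Y] at hA hA' ⊢
    clear d1 d2 d3 hr hpwb hq
    -- With the conjugates treated as independent variables, the claim is a rational identity modulo
    -- 1 - |h|² = y.
    generalize conj (diskConn (h w)) = A' at *
    generalize diskConn (h w) = A at *
    generalize conj (wirt h w) = p' at *
    generalize conj (wirtBar h w) = b' at *
    generalize (diskGap (h w) : ℂ) = y at *
    generalize conj (h w) = H' at *
    rw [hA']
    rw [hA'] at hYY
    subst hA
    linear_combination (-2 * (wirt h w * p' + wirtBar h w * b') / (y - ε) ^ 2) * hYY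

/-- Pointwise consequence of the maximum principle. -/
theorem logQuot_max_bound {ε g Y P B T : ℝ} (hg : 0 < g) (hε : 0 < ε) (hY : ε < Y) (hY1 : Y ≤ 1)
    (hB : 0 ≤ B) (hBP : B ≤ P) (hT : T * Y ^ 2 ≤ P * B)
    (hle : 2 * ((-(P ^ 2 + B ^ 2) + 4 * Y * T) * (Y - ε)
        - ((1 - Y) * (P ^ 2 + B ^ 2) + 2 * Y ^ 2 * T)) / (Y - ε) ^ 2
        + 2 / g ^ 2 - 4 * T + 4 * B ^ 2 / Y ^ 2 ≤ 0) :
    (Y - ε) ^ 2 ≤ 6 * g ^ 2 * P ^ 2 := by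
  have hZ : 0 < Y - ε := sub_pos.2 hY
  have hY0 : 0 < Y := hε.trans hY
  -- The terms in T, whose sign is unknown, cancel up to one carrying the factor ε².
  have h1 : 2 * ((-(P ^ 2 + B ^ 2) + 4 * Y * T) * (Y - ε)
        - ((1 - Y) * (P ^ 2 + B ^ 2) + 2 * Y ^ 2 * T)) / (Y - ε) ^ 2 - 4 * T
      = -(2 * (P ^ 2 + B ^ 2) * ((Y - ε) + (1 - Y)) + 4 * ε ^ 2 * T) / (Y - ε) ^ 2 := by
    field_simp; ring
  have h2 : 0 ≤ 4 * B ^ 2 / Y ^ 2 := by positivity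
  have h3 : 2 / g ^ 2 ≤ (2 * (P ^ 2 + B ^ 2) * ((Y - ε) + (1 - Y)) + 4 * ε ^ 2 * T)
      / (Y - ε) ^ 2 := by
    have : 2 / g ^ 2 ≤ -(-(2 * (P ^ 2 + B ^ 2) * ((Y - ε) + (1 - Y)) + 4 * ε ^ 2 * T)
      / (Y - ε) ^ 2) := by linarith
    rwa [← neg_div, neg_neg] at this
  rw [div_le_div_iff₀ (by positivity) (by positivity)] at h3
  have h4 : ε ^ 2 * T ≤ P ^ 2 := by
    rcases le_or_gt T 0 with hT0 | hT0
    · nlinarith [sq_nonneg ε, sq_nonneg P]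
    · have : ε ^ 2 ≤ Y ^ 2 := by gcongr
      nlinarith
  have h5 : (P ^ 2 + B ^ 2) * ((Y - ε) + (1 - Y)) ≤ 2 * P ^ 2 := by
    have : (P ^ 2 + B ^ 2) ≤ 2 * P ^ 2 := by nlinarith
    have h6 : 0 ≤ (P ^ 2 + B ^ 2) := by positivity
    nlinarith
  have h7 : 0 ≤ g ^ 2 := sq_nonneg g
  -- `h3`, `h4` and `h5` together give 2 (Y - ε)² ≤ 8 g² P²; the constant 6 leaves slack.
  nlinarith

/-- An orientation preserving, proper harmonic map from the disk to the hyperbolic plane expands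
the hyperbolic metric, in the direction of `h_w`, by a definite factor. -/
theorem harmonic_expanding_bound (hmaps : MapsTo h disk disk)
    (hs : ∀ z ∈ disk, ContDiffAt ℝ ∞ h z)
    (hh : ∀ z ∈ disk, wirtBar (wirt h) z = -2 * diskConn (h z) * wirt h z * wirtBar h z)
    (hor : ∀ z ∈ disk, ‖wirtBar h z‖ < ‖wirt h z‖)
    (hcpt : ∀ ε > 0, IsCompact {z | z ∈ disk ∧ ε ≤ diskGap (h z)}) (hw : w ∈ disk) :
    diskGap (h w) ^ 2 ≤ 6 * diskGap w ^ 2 * ‖wirt h w‖ ^ 2 := by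
  have hppos : ∀ z ∈ disk, 0 < ‖wirt h z‖ := fun z hz => (norm_nonneg _).trans_lt (hor z hz)
  have hcont : ContinuousOn h disk := fun z hz => (hs z hz).continuousAt.continuousWithinAt
  have hcontp : ContinuousOn (wirt h) disk := fun z hz =>
    (wirt_contDiffAt (hs z hz)).continuousAt.continuousWithinAt
  have main : ∀ ε > 0, ε < diskGap (h w) →
      (diskGap (h w) - ε) ^ 2 ≤ 6 * diskGap w ^ 2 * ‖wirt h w‖ ^ 2 := by
    intro ε hε hεw
    set K := {z | z ∈ disk ∧ ε ≤ diskGap (h z)} with hK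
    -- Subtracting ε makes E vanish where `diskGap (h z) = ε`. As E is positive at w, its maximum
    -- over K lies where `diskGap (h z) > ε`, an open condition, so it is a local maximum.
    set E : ℂ → ℝ := fun z => (diskGap (h z) - ε) / (diskGap z * ‖wirt h z‖) with hE
    have hKd : K ⊆ disk := fun z hz => hz.1
    have hEc : ContinuousOn E K := by
      refine ContinuousOn.mono ?_ hKd
      refine ((continuous_diskGap.comp_continuousOn hcont).sub continuousOn_const).div
        (continuous_diskGap.continuousOn.mul hcontp.norm) fun z hz => ?_
      exact (mul_pos (diskGap_pos hz) (hppos z hz)).ne'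
    obtain ⟨m, hmK, hmax⟩ := (hcpt ε hε).exists_isMaxOn ⟨w, hw, hεw.le⟩ hEc
    have hEw : 0 < E w := div_pos (sub_pos.2 hεw) (mul_pos (diskGap_pos hw) (hppos w hw))
    have hEm : E w ≤ E m := hmax ⟨hw, hεw.le⟩
    have hmd : m ∈ disk := hmK.1
    have hden := mul_pos (diskGap_pos hmd) (hppos m hmd)
    have hmε : ε < diskGap (h m) := by
      have : 0 < E m := hEw.trans_le hEm
      exact sub_pos.1 ((div_pos_iff_of_pos_right hden).1 this)
    have hnear : ∀ᶠ z in 𝓝 m, z ∈ disk ∧ ε < diskGap (h z) :=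
      (isOpen_disk.eventually_mem hmd).and <|
        (continuous_diskGap.continuousAt.comp (hs m hmd).continuousAt).eventually_const_lt hmε
    have hlog : ∀ z, z ∈ disk → ε < diskGap (h z) → 2 * Real.log (diskGap (h z) - ε)
        - 2 * Real.log (diskGap z) - Real.log (‖wirt h z‖ ^ 2) = 2 * Real.log (E z) := by
      intro z hz hzε
      rw [hE]
      dsimp only
      rw [Real.log_div (sub_pos.2 hzε).ne' (mul_pos (diskGap_pos hz) (hppos z hz)).ne',
        Real.log_mul (diskGap_pos hz).ne' (hppos z hz).ne', Real.log_pow]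
      push_cast; ring
    have hlm : IsLocalMax (fun z => 2 * Real.log (diskGap (h z) - ε)
        - 2 * Real.log (diskGap z) - Real.log (‖wirt h z‖ ^ 2)) m := by
      filter_upwards [hnear] with z ⟨hz, hzε⟩
      rw [hlog z hz hzε, hlog m hmd hmε]
      have h0 : 0 < E z := div_pos (sub_pos.2 hzε) (mul_pos (diskGap_pos hz) (hppos z hz))
      have := Real.log_le_log h0 (hmax ⟨hz, hzε.le⟩ : E z ≤ E m)
      linarith
    have hh' : ∀ᶠ z in 𝓝 m,
        wirtBar (wirt h) z = -2 * diskConn (h z) * wirt h z * wirtBar h z := by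
      filter_upwards [hnear] with z hz using hh z hz.1
    obtain ⟨s, hs2⟩ := hasWirt_logQuotWirt hmd (hmaps hmd) (hs m hmd) hh'
      (norm_pos_iff.1 (hppos m hmd)) hmε
    have hle := hlm.re_laplacian_nonpos (Q := logQuotWirt h ε) (by
      filter_upwards [hnear] with z hz
      exact hasWirt_logQuot hz.1 (hs z hz.1) (hh z hz.1) (norm_pos_iff.1 (hppos z hz.1)) hz.2) hs2
    rw [Complex.ofReal_re] at hle
    have hb := logQuot_max_bound (diskGap_pos hmd) hε hmε (diskGap_le_one _) (norm_nonneg _)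
      (hor m hmd).le ?_ hle
    · have hE2 : E m ^ 2 ≤ 6 := by
        rw [hE]; dsimp only
        rw [div_pow, div_le_iff₀ (by positivity)]
        linarith
      have hE3 : E w ^ 2 ≤ 6 := (pow_le_pow_left₀ hEw.le hEm 2).trans hE2
      have hdw := mul_pos (diskGap_pos hw) (hppos w hw)
      rw [hE] at hE3; dsimp only at hE3
      rw [div_pow, div_le_iff₀ (by positivity)] at hE3
      linarith
    · have hYm := diskGap_pos (hmaps hmd)
      have h1 := Complex.re_le_norm (diskConn (h m) ^ 2 * wirt h m * wirtBar h m)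
      have h2 : ‖diskConn (h m)‖ * diskGap (h m) = ‖h m‖ := by
        simp only [diskConn, norm_div, RCLike.norm_conj, Complex.norm_real, Real.norm_eq_abs,
          abs_of_pos hYm]
        field_simp
      have h3 : ‖h m‖ ≤ 1 := (mem_disk.1 (hmaps hmd)).le
      calc _ ≤ ‖diskConn (h m) ^ 2 * wirt h m * wirtBar h m‖ * diskGap (h m) ^ 2 := by gcongr
        _ = (‖diskConn (h m)‖ * diskGap (h m)) ^ 2 * (‖wirt h m‖ * ‖wirtBar h m‖) := by
          simp only [norm_mul, norm_pow]; ring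
        _ ≤ 1 * (‖wirt h m‖ * ‖wirtBar h m‖) := by
          rw [h2]; gcongr; exact pow_le_one₀ (norm_nonneg _) h3
        _ = _ := one_mul _
  have hY := diskGap_pos (hmaps hw)
  -- The bound is uniform in ε, so ε may tend to 0.
  have hlim : Tendsto (fun ε : ℝ => (diskGap (h w) - ε) ^ 2) (𝓝[>] 0) (𝓝 (diskGap (h w) ^ 2)) := by
    have : Continuous fun ε : ℝ => (diskGap (h w) - ε) ^ 2 := by fun_prop
    have h1 := this.tendsto 0
    rw [sub_zero] at h1
    exact h1.mono_left nhdsWithin_le_nhds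
  refine le_of_tendsto hlim ?_
  filter_upwards [Ioo_mem_nhdsGT hY] with ε hε using main ε hε.1 hε.2

end Bound

/-! ### Singular values, Hopf differential and conjugation. -/

theorem norm_sub_mul_le_norm_fderiv (h : ℂ → ℂ) (w v : ℂ) :
    |‖wirt h w‖ - ‖wirtBar h w‖| * ‖v‖ ≤ ‖fderiv ℝ h w v‖ := by
  rw [fderiv_apply_wirt]
  have h1 := abs_norm_sub_norm_le (wirt h w * v) (-(wirtBar h w * conj v))
  simp only [norm_neg, norm_mul, RCLike.norm_conj, sub_neg_eq_add] at h1
  rwa [← sub_mul, abs_mul, abs_norm] at h1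

theorem hopf_eq_wirt_mul {h : ℂ → ℂ} {w : ℂ} (hd : DifferentiableAt ℝ h w) :
    hopf h w = (hypFactor (h w) : ℂ) ^ 2 * (wirt h w * conj (wirtBar h w)) := by
  rw [hopf, hd.hasWirt.star.wirt_eq, mul_assoc]

theorem hypFactor_pos {z : ℂ} (hz : z ∈ disk) : 0 < hypFactor z :=
  div_pos two_pos (diskGap_pos hz)

theorem norm_hopf {h : ℂ → ℂ} {w : ℂ} (hd : DifferentiableAt ℝ h w) :
    ‖hopf h w‖ = hypFactor (h w) ^ 2 * (‖wirt h w‖ * ‖wirtBar h w‖) := by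
  rw [hopf_eq_wirt_mul hd]
  simp

namespace IsConformalMinimalImmersion

variable {h : ℂ → ℂ} {f : ℂ → ℝ} {w : ℂ}

theorem contDiffAt_fst (hX : IsConformalMinimalImmersion h f) (hw : w ∈ disk) :
    ContDiffAt ℝ ∞ h w := hX.smooth_fst.contDiffAt (isOpen_disk.mem_nhds hw)

theorem differentiableAt_fst (hX : IsConformalMinimalImmersion h f) (hw : w ∈ disk) :
    DifferentiableAt ℝ h w := (hX.contDiffAt_fst hw).differentiableAt (by simp)

theorem harmonic_eq (hX : IsConformalMinimalImmersion h f) (hw : w ∈ disk) :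
    wirtBar (wirt h) w = -2 * diskConn (h w) * wirt h w * wirtBar h w := by
  have h1 := hX.harmonic_fst w hw
  rw [wirt_log_hypFactor (hX.mapsTo hw)] at h1
  linear_combination h1

/-- The conformality relation between the Hopf differential of `h` and the derivative of `f`. -/
theorem hopf_eq (hX : IsConformalMinimalImmersion h f) (hw : w ∈ disk) :
    hopf h w = -((fderiv ℝ f w 1 - Complex.I * fderiv ℝ f w Complex.I) / 2) ^ 2 := by
  obtain ⟨l, -, hl⟩ := hX.conformal w hw
  have h1 := hl 1 1
  have h2 := hl Complex.I Complex.I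
  have h3 := hl 1 Complex.I
  rw [hopf_eq_wirt_mul (hX.differentiableAt_fst hw)]
  simp only [firstForm, fderiv_apply_wirt, Complex.inner] at h1 h2 h3
  generalize wirt h w = p at *
  generalize wirtBar h w = b at *
  generalize fderiv ℝ f w 1 = f1 at *
  generalize fderiv ℝ f w Complex.I = f2 at *
  generalize hypFactor (h w) = s at *
  simp at h1 h2 h3
  apply Complex.ext
  · simp [pow_two]
    linarith
  · simp [pow_two]
    linarith

/-- Half the trace of the first fundamental form is σ²(|h_w|² + |h_w̄|²) + |∇f|²/2, and |∇f|²/2 =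
2|f_w|² = 2|φ| = 2σ²|h_w||h_w̄| by `hopf_eq`. -/
theorem sq_norm_add (hX : IsConformalMinimalImmersion h f) (hw : w ∈ disk) :
    hypFactor (h w) ^ 2 * (‖wirt h w‖ + ‖wirtBar h w‖) ^ 2 = firstForm h f w 1 1 := by
  have hn := norm_hopf (hX.differentiableAt_fst hw)
  rw [hX.hopf_eq hw, norm_neg, norm_pow, norm_div, div_pow, ← Complex.normSq_eq_norm_sq] at hn
  obtain ⟨l, -, hl⟩ := hX.conformal w hw
  have h1 := hl 1 1
  have h2 := hl Complex.I Complex.I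
  have hp := Complex.normSq_eq_norm_sq (wirt h w)
  have hb := Complex.normSq_eq_norm_sq (wirtBar h w)
  have : hypFactor (h w) ^ 2 * (‖wirt h w‖ + ‖wirtBar h w‖) ^ 2 =
      hypFactor (h w) ^ 2 * (‖wirt h w‖ ^ 2 + ‖wirtBar h w‖ ^ 2)
        + 2 * (hypFactor (h w) ^ 2 * (‖wirt h w‖ * ‖wirtBar h w‖)) := by ring
  rw [this, ← hn, ← hp, ← hb, h1]
  simp only [firstForm, fderiv_apply_wirt, Complex.inner] at h1 h2
  generalize wirt h w = p at *
  generalize wirtBar h w = b at *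
  generalize fderiv ℝ f w 1 = f1 at *
  generalize fderiv ℝ f w Complex.I = f2 at *
  generalize hypFactor (h w) = s at *
  simp at h1 h2
  simp [Complex.normSq_apply]
  linarith

/-- Since f is harmonic on a disk it is Re F for a holomorphic F; then f_w = F'/2 and φ = -f_w². -/
theorem exists_holomorphic (hX : IsConformalMinimalImmersion h f) :
    ∃ F : ℂ → ℂ, DifferentiableOn ℂ F disk ∧
      ∀ w ∈ disk, ‖hopf h w‖ = (‖deriv F w‖ / 2) ^ 2 := by
  obtain ⟨F, hF, hre⟩ := hX.harmonic_snd.exists_analyticOnNhd_ball_re_eq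
  refine ⟨F, hF.differentiableOn, fun w hw => ?_⟩
  have hd := (hF w hw).differentiableAt.hasDerivAt
  have h1 : HasFDerivAt f (Complex.reCLM.comp
      ((ContinuousLinearMap.toSpanSingleton ℂ (deriv F w)).restrictScalars ℝ)) w := by
    refine (Complex.reCLM.hasFDerivAt.comp w
      (hd.hasFDerivAt.restrictScalars ℝ)).congr_of_eventuallyEq ?_
    filter_upwards [isOpen_disk.mem_nhds hw] with z hz using (hre hz).symm
  rw [hX.hopf_eq hw, h1.fderiv]
  have : ((((1 : ℂ) * deriv F w).re : ℂ) - Complex.I * ((Complex.I * deriv F w).re : ℂ))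
      = deriv F w := by
    apply Complex.ext <;> simp
  simp only [ContinuousLinearMap.comp_apply, ContinuousLinearMap.coe_restrictScalars',
    ContinuousLinearMap.toSpanSingleton_apply, Complex.reCLM_apply, smul_eq_mul, this]
  simp

/-- Conjugate immersions have the same Jacobian up to sign. -/
theorem conjugate_norm_sub {h' : ℂ → ℂ} {f' : ℂ → ℝ} (hX : IsConformalMinimalImmersion h f)
    (hX' : IsConformalMinimalImmersion h' f') (hconj : IsConjugate h f h' f') (hw : w ∈ disk) :
    hypFactor (h' w) * |‖wirt h' w‖ - ‖wirtBar h' w‖| =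
      hypFactor (h w) * |‖wirt h w‖ - ‖wirtBar h w‖| := by
  have h1 := hX.sq_norm_add hw
  have h2 := hX'.sq_norm_add hw
  rw [hconj.1 w hw, ← h1] at h2
  have h3 := norm_hopf (hX.differentiableAt_fst hw)
  have h4 := norm_hopf (hX'.differentiableAt_fst hw)
  rw [hconj.2 w hw, norm_neg, h3] at h4
  have hs := (hypFactor_pos (hX.mapsTo hw)).le
  have hs' := (hypFactor_pos (hX'.mapsTo hw)).le
  rw [← abs_of_nonneg hs, ← abs_of_nonneg hs', ← abs_mul, ← abs_mul, ← sq_eq_sq_iff_abs_eq_abs]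
  -- (a - b)² = (a + b)² - 4ab, where both terms on the right agree for conjugate immersions.
  linear_combination h2 + 4 * h4

end IsConformalMinimalImmersion

/-! ### Smooth paths of finite length through a sequence of points. -/

/-- The increasing reparametrization `t ↦ t / (1 - t)` of `[0, 1)` by `[0, ∞)`. -/
noncomputable def halfLine (t : ℝ) : ℝ := t / (1 - t)

theorem halfLine_contDiffAt {t : ℝ} (ht : t < 1) : ContDiffAt ℝ ∞ halfLine t := by
  unfold halfLine
  exact contDiffAt_id.div (contDiffAt_const.sub contDiffAt_id) (sub_pos.2 ht).ne'

theorem halfLine_monotoneOn : MonotoneOn halfLine (Iio 1) := by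
  intro s hs t ht hst
  have hs' : 0 < 1 - s := sub_pos.2 hs
  have ht' : 0 < 1 - t := sub_pos.2 ht
  unfold halfLine
  rw [div_le_div_iff₀ hs' ht']
  nlinarith

theorem halfLine_nonneg {t : ℝ} (h0 : 0 ≤ t) (h1 : t < 1) : 0 ≤ halfLine t :=
  div_nonneg h0 (sub_pos.2 h1).le

/-- The parameter at which `halfLine` takes the value `k`. -/
noncomputable def knot (k : ℕ) : ℝ := k / (k + 1)

theorem knot_nonneg (k : ℕ) : 0 ≤ knot k := by unfold knot; positivity

theorem knot_lt_one (k : ℕ) : knot k < 1 := by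
  unfold knot; rw [div_lt_one (by positivity)]; linarith

theorem halfLine_knot (k : ℕ) : halfLine (knot k) = k := by
  unfold halfLine knot
  have : (k : ℝ) + 1 ≠ 0 := by positivity
  field_simp; ring

theorem knot_le_succ (k : ℕ) : knot k ≤ knot (k + 1) := by
  unfold knot; push_cast
  rw [div_le_div_iff₀ (by positivity) (by positivity)]; nlinarith

theorem tendsto_knot : Tendsto knot atTop (𝓝 1) := tendsto_natCast_div_add_atTop (1 : ℝ)

theorem le_halfLine {t : ℝ} {k : ℕ} (h1 : knot k ≤ t) (h2 : t < 1) : (k : ℝ) ≤ halfLine t := by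
  rw [← halfLine_knot k]; exact halfLine_monotoneOn (knot_lt_one k) h2 h1

/-- The `k`-th transition function on `[0, 1)`: it climbs from `0` to `1` between consecutive
knots. -/
noncomputable def knotStep (k : ℕ) (t : ℝ) : ℝ := Real.smoothTransition (halfLine t - k)

theorem knotStep_contDiffAt (k : ℕ) {t : ℝ} (ht : t < 1) : ContDiffAt ℝ ∞ (knotStep k) t :=
  Real.smoothTransition.contDiffAt.comp t ((halfLine_contDiffAt ht).sub contDiffAt_const)

theorem knotStep_mem (k : ℕ) (t : ℝ) : knotStep k t ∈ Icc (0 : ℝ) 1 :=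
  ⟨Real.smoothTransition.nonneg _, Real.smoothTransition.le_one _⟩

theorem knotStep_monotoneOn (k : ℕ) : MonotoneOn (knotStep k) (Iio 1) := fun _ hs _ ht hst =>
  Real.smoothTransition.monotone (sub_le_sub_right (halfLine_monotoneOn hs ht hst) _)

theorem knotStep_deriv_nonneg (k : ℕ) {t : ℝ} (ht : t < 1) : 0 ≤ deriv (knotStep k) t := by
  have h1 : derivWithin (knotStep k) (Iio 1) t = deriv (knotStep k) t :=
    derivWithin_of_isOpen isOpen_Iio ht
  rw [← h1]
  exact (knotStep_monotoneOn k).derivWithin_nonneg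

/-- The smooth path that runs through the points `p k` along segments. -/
noncomputable def polyPath (p : ℕ → ℂ) (t : ℝ) : ℂ :=
  p 0 + ∑' k, knotStep k t • (p (k + 1) - p k)

section PolyPath

variable {p : ℕ → ℂ} {t : ℝ}

theorem polyPath_eq_sum {K : ℕ} (hK : halfLine t ≤ K) :
    polyPath p t = p 0 + ∑ k ∈ Finset.range K, knotStep k t • (p (k + 1) - p k) := by
  unfold polyPath
  rw [tsum_eq_sum]
  intro k hk
  have : (K : ℝ) ≤ k := by exact_mod_cast (not_lt.1 (Finset.mem_range.not.1 hk))
  rw [knotStep, Real.smoothTransition.zero_of_nonpos (by linarith), zero_smul]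

/-- Between consecutive knots the earlier transitions are complete and telescope to `p k`, the later
ones have not begun, and a single one moves. -/
theorem polyPath_eq_segment {k : ℕ} (h1 : (k : ℝ) ≤ halfLine t) (h2 : halfLine t ≤ k + 1) :
    polyPath p t = p k + knotStep k t • (p (k + 1) - p k) := by
  rw [polyPath_eq_sum (K := k + 1) (by exact_mod_cast h2), Finset.sum_range_succ]
  have : ∑ j ∈ Finset.range k, knotStep j t • (p (j + 1) - p j)
      = ∑ j ∈ Finset.range k, (p (j + 1) - p j) := by
    refine Finset.sum_congr rfl fun j hj => ?_
    have : (j : ℝ) + 1 ≤ k := by exact_mod_cast (Finset.mem_range.1 hj)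
    rw [knotStep, Real.smoothTransition.one_of_one_le (by linarith), one_smul]
  rw [this, Finset.sum_range_sub]
  ring

theorem polyPath_knot (k : ℕ) : polyPath p (knot k) = p k := by
  rw [polyPath_eq_segment (k := k) (by rw [halfLine_knot]) (by rw [halfLine_knot]; linarith),
    knotStep, halfLine_knot]
  simp

theorem polyPath_eventuallyEq (ht : t < 1) {K : ℕ} (hK : halfLine t < K) : polyPath p =ᶠ[𝓝 t]
    fun t => p 0 + ∑ k ∈ Finset.range K, knotStep k t • (p (k + 1) - p k) := by
  filter_upwards [(halfLine_contDiffAt ht).continuousAt.eventually_lt_const hK] with s hs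
    using polyPath_eq_sum hs.le

/-- The series is locally a finite sum of smooth terms; the transitions are flat at the knots, so
changes of direction there do no harm. -/
theorem polyPath_contDiffAt (ht : t < 1) : ContDiffAt ℝ ∞ (polyPath p) t := by
  obtain ⟨K, hK⟩ := exists_nat_gt (halfLine t)
  refine ContDiffAt.congr_of_eventuallyEq ?_ (polyPath_eventuallyEq ht hK)
  exact contDiffAt_const.add (ContDiffAt.sum fun k _ => (knotStep_contDiffAt k ht).smul
    contDiffAt_const)

theorem norm_deriv_polyPath_le (ht : t < 1) {K : ℕ} (hK : halfLine t < K) :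
    ‖deriv (polyPath p) t‖ ≤
      ∑ k ∈ Finset.range K, deriv (knotStep k) t * ‖p (k + 1) - p k‖ := by
  have hd : HasDerivAt (fun t => p 0 + ∑ k ∈ Finset.range K, knotStep k t • (p (k + 1) - p k))
      (∑ k ∈ Finset.range K, deriv (knotStep k) t • (p (k + 1) - p k)) t :=
    (HasDerivAt.fun_sum fun k _ => (((knotStep_contDiffAt k ht).differentiableAt
      (by simp)).hasDerivAt.smul_const (p (k + 1) - p k))).const_add _
  rw [(polyPath_eventuallyEq ht hK).deriv_eq, hd.deriv]
  refine (norm_sum_le _ _).trans (Finset.sum_le_sum fun k _ => ?_)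
  rw [norm_smul, Real.norm_of_nonneg (knotStep_deriv_nonneg k ht)]

theorem continuousOn_deriv_polyPath : ContinuousOn (deriv (polyPath p)) (Iio 1) :=
  ContDiffOn.continuousOn_deriv_of_isOpen (n := ∞)
    (fun _ ht => (polyPath_contDiffAt ht).contDiffWithinAt) isOpen_Iio (by simp)

theorem continuousOn_deriv_knotStep (k : ℕ) : ContinuousOn (deriv (knotStep k)) (Iio 1) :=
  ContDiffOn.continuousOn_deriv_of_isOpen (n := ∞)
    (fun _ ht => (knotStep_contDiffAt k ht).contDiffWithinAt) isOpen_Iio (by simp)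

/-- Each transition is monotone with total increase at most 1, so the length is at most the sum of
the steps. -/
theorem integral_norm_deriv_polyPath_le (hsum : Summable fun k => ‖p (k + 1) - p k‖) {b : ℝ}
    (hb0 : 0 ≤ b) (hb1 : b < 1) :
    ∫ t in (0 : ℝ)..b, ‖deriv (polyPath p) t‖ ≤ ∑' k, ‖p (k + 1) - p k‖ := by
  obtain ⟨K, hK⟩ := exists_nat_gt (halfLine b)
  have hsub : uIcc 0 b ⊆ Iio (1 : ℝ) := by
    rw [uIcc_of_le hb0]; exact fun t ht => ht.2.trans_lt hb1
  have hc : ContinuousOn (fun t => ∑ k ∈ Finset.range K,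
      deriv (knotStep k) t * ‖p (k + 1) - p k‖) (uIcc 0 b) :=
    continuousOn_finsetSum _ fun k _ =>
      ((continuousOn_deriv_knotStep k).mono hsub).mul continuousOn_const
  have h1 : ∫ t in (0 : ℝ)..b, ‖deriv (polyPath p) t‖ ≤
      ∫ t in (0 : ℝ)..b, ∑ k ∈ Finset.range K, deriv (knotStep k) t * ‖p (k + 1) - p k‖ := by
    refine intervalIntegral.integral_mono_on hb0
      (continuousOn_deriv_polyPath.norm.mono hsub).intervalIntegrable hc.intervalIntegrable
      fun t ht => ?_
    exact norm_deriv_polyPath_le (ht.2.trans_lt hb1)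
      ((halfLine_monotoneOn (ht.2.trans_lt hb1) hb1 ht.2).trans_lt hK)
  have h2 : ∫ t in (0 : ℝ)..b, ∑ k ∈ Finset.range K, deriv (knotStep k) t * ‖p (k + 1) - p k‖
      = ∑ k ∈ Finset.range K, knotStep k b * ‖p (k + 1) - p k‖
        - ∑ k ∈ Finset.range K, knotStep k 0 * ‖p (k + 1) - p k‖ :=
    intervalIntegral.integral_eq_sub_of_hasDerivAt
      (f := fun t => ∑ k ∈ Finset.range K, knotStep k t * ‖p (k + 1) - p k‖)
      (fun t ht => HasDerivAt.fun_sum fun k _ => (((knotStep_contDiffAt k (hsub ht)).differentiableAt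
        (by simp)).hasDerivAt.mul_const _)) hc.intervalIntegrable
  have h3 : 0 ≤ ∑ k ∈ Finset.range K, knotStep k 0 * ‖p (k + 1) - p k‖ :=
    Finset.sum_nonneg fun k _ => mul_nonneg (knotStep_mem k 0).1 (norm_nonneg _)
  have h4 : ∑ k ∈ Finset.range K, knotStep k b * ‖p (k + 1) - p k‖ ≤
      ∑ k ∈ Finset.range K, ‖p (k + 1) - p k‖ :=
    Finset.sum_le_sum fun k _ => mul_le_of_le_one_left (norm_nonneg _) (knotStep_mem k b).2
  have h5 := hsum.sum_le_tsum (Finset.range K) fun k _ => norm_nonneg _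
  linarith

theorem hasFiniteLength_polyPath (hsum : Summable fun k => ‖p (k + 1) - p k‖) :
    HasFiniteLength (polyPath p) := by
  have h1 : IntegrableOn (fun t => ‖deriv (polyPath p) t‖) (Ioc 0 1) := by
    refine integrableOn_Ioc_of_intervalIntegral_norm_bounded_right
      (I := ∑' k, ‖p (k + 1) - p k‖) (b := knot) (l := atTop) (fun k => ?_) tendsto_knot
      (.of_forall fun k => ?_)
    · refine (ContinuousOn.integrableOn_Icc ?_).mono_set Ioc_subset_Icc_self
      exact continuousOn_deriv_polyPath.norm.mono fun t ht => ht.2.trans_lt (knot_lt_one k)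
    · rw [← intervalIntegral.integral_of_le (knot_nonneg k)]
      simpa using integral_norm_deriv_polyPath_le hsum (knot_nonneg k) (knot_lt_one k)
  unfold HasFiniteLength
  rw [integrableOn_Ico_iff_integrableOn_Ioo]
  exact h1.mono_set Ioo_subset_Ioc_self

theorem isDivergentPath_polyPath (hp : ∀ k, p k ∈ disk)
    (hsum : Summable fun k => ‖p (k + 1) - p k‖) (hlim : Tendsto (fun k => ‖p k‖) atTop (𝓝 1)) :
    IsDivergentPath (polyPath p) where
  contDiffOn := fun t ht => ((polyPath_contDiffAt ht.2).of_le (by simp)).contDiffWithinAt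
  mapsTo := by
    intro t ht
    have h0 := halfLine_nonneg ht.1 ht.2
    rw [polyPath_eq_segment (Nat.floor_le h0) (Nat.lt_floor_add_one _).le]
    exact (convex_ball (0 : ℂ) 1).add_smul_sub_mem (hp _) (hp _) (knotStep_mem _ _)
  leaves := by
    intro K hK hKd
    obtain ⟨r, hr1, hr⟩ : ∃ r < 1, ∀ z ∈ K, ‖z‖ ≤ r := by
      rcases K.eq_empty_or_nonempty with rfl | hne
      · exact ⟨0, one_pos, by simp⟩
      · obtain ⟨m, hm, hmax⟩ := hK.exists_isMaxOn hne continuous_norm.continuousOn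
        exact ⟨‖m‖, mem_disk.1 (hKd hm), fun z hz => hmax hz⟩
    -- On the k-th segment the norm is at least ‖p k‖ - ‖p (k + 1) - p k‖, which exceeds r for large
    -- k.
    have h1 : Tendsto (fun k => ‖p k‖ - ‖p (k + 1) - p k‖) atTop (𝓝 1) := by
      simpa using hlim.sub hsum.tendsto_atTop_zero
    obtain ⟨N, hN⟩ := eventually_atTop.1 (h1.eventually_const_lt hr1)
    filter_upwards [Ioo_mem_nhdsLT (knot_lt_one N)] with t ht hmem
    have h2 := le_halfLine ht.1.le ht.2
    have h0 : 0 ≤ halfLine t := (Nat.cast_nonneg N).trans h2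
    have h3 := hN _ (Nat.le_floor h2)
    rw [polyPath_eq_segment (Nat.floor_le h0) (Nat.lt_floor_add_one _).le] at hmem
    have h4 := hr _ hmem
    set k := ⌊halfLine t⌋₊
    have h5 : ‖knotStep k t • (p (k + 1) - p k)‖ ≤ ‖p (k + 1) - p k‖ := by
      rw [norm_smul, Real.norm_of_nonneg (knotStep_mem k t).1]
      exact mul_le_of_le_one_left (norm_nonneg _) (knotStep_mem k t).2
    have h6 := norm_sub_le_norm_add (p k) (knotStep k t • (p (k + 1) - p k))
    linarith

end PolyPath

/-! ### From integrability along paths to the little Bloch condition. -/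

/-- A holomorphic function on the disk whose derivative is integrable along every divergent path of
finite length has vanishing oscillation along sequences with summable steps. -/
theorem tendsto_sub_of_integrable_along_paths {F : ℂ → ℂ} (hF : DifferentiableOn ℂ F disk)
    (hint : ∀ γ : ℝ → ℂ, IsDivergentPath γ → HasFiniteLength γ →
      IntegrableOn (fun t => ‖deriv F (γ t)‖ * ‖deriv γ t‖) (Ico 0 1))
    {p : ℕ → ℂ} (hp : ∀ k, p k ∈ disk)
    (hsum : Summable fun k => ‖p (k + 1) - p k‖) (hlim : Tendsto (fun k => ‖p k‖) atTop (𝓝 1)) :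
    Tendsto (fun k => ‖F (p (k + 1)) - F (p k)‖) atTop (𝓝 0) := by
  have hdiv := isDivergentPath_polyPath hp hsum hlim
  have hi := hint _ hdiv (hasFiniteLength_polyPath hsum)
  set g : ℝ → ℝ := fun t => ‖deriv F (polyPath p t)‖ * ‖deriv (polyPath p) t‖ with hg
  have hi' : IntegrableOn g (uIcc 0 1) := by
    rw [uIcc_of_le zero_le_one, integrableOn_Icc_iff_integrableOn_Ico]; exact hi
  have hcont := intervalIntegral.continuousOn_primitive_interval hi'
  have hlimI : Tendsto (fun k => ∫ t in (0 : ℝ)..knot k, g t) atTop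
      (𝓝 (∫ t in (0 : ℝ)..1, g t)) := by
    refine (hcont 1 right_mem_uIcc).tendsto.comp
      (tendsto_nhdsWithin_iff.2 ⟨tendsto_knot, .of_forall fun k => ?_⟩)
    rw [uIcc_of_le zero_le_one]
    exact ⟨knot_nonneg k, (knot_lt_one k).le⟩
  -- Differences of consecutive terms of a convergent sequence of integrals; each bounds the
  -- corresponding increment of F.
  have hz : Tendsto (fun k => ∫ t in knot k..knot (k + 1), g t) atTop (𝓝 0) := by
    have h1 := (hlimI.comp (tendsto_add_atTop_nat 1)).sub hlimI
    rw [sub_self] at h1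
    refine h1.congr fun k => ?_
    refine intervalIntegral.integral_interval_sub_left ?_ ?_ <;>
    · rw [intervalIntegrable_iff_integrableOn_Icc_of_le (knot_nonneg _)]
      exact hi.mono_set fun t ht => ⟨ht.1, ht.2.trans_lt (knot_lt_one _)⟩
  refine squeeze_zero (fun k => norm_nonneg _) (fun k => ?_) hz
  have hsub : uIcc (knot k) (knot (k + 1)) ⊆ Ico 0 1 := by
    rw [uIcc_of_le (knot_le_succ k)]
    exact fun t ht => ⟨(knot_nonneg k).trans ht.1, ht.2.trans_lt (knot_lt_one _)⟩
  have hFd : ∀ z ∈ disk, HasDerivAt F (deriv F z) z := fun z hz =>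
    (hF.differentiableAt (isOpen_disk.mem_nhds hz)).hasDerivAt
  have hderiv : ∀ t ∈ uIcc (knot k) (knot (k + 1)), HasDerivAt (fun t => F (polyPath p t))
      (deriv F (polyPath p t) * deriv (polyPath p) t) t := fun t ht =>
    (hFd _ (hdiv.mapsTo (hsub ht))).comp t
      (((polyPath_contDiffAt (hsub ht).2).differentiableAt (by simp)).hasDerivAt)
  have hcd : ContinuousOn (fun t => deriv F (polyPath p t) * deriv (polyPath p) t)
      (uIcc (knot k) (knot (k + 1))) := by
    refine ContinuousOn.mul ?_ (continuousOn_deriv_polyPath.mono fun t ht => (hsub ht).2)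
    exact (hF.deriv isOpen_disk).continuousOn.comp
      (hdiv.contDiffOn.continuousOn.mono hsub) fun t ht => hdiv.mapsTo (hsub ht)
  have h2 := intervalIntegral.integral_eq_sub_of_hasDerivAt hderiv hcd.intervalIntegrable
  rw [polyPath_knot, polyPath_knot] at h2
  rw [← h2]
  refine (intervalIntegral.norm_integral_le_integral_norm (knot_le_succ k)).trans_eq ?_
  simp only [norm_mul, hg]

/-- A holomorphic function on the disk whose derivative is integrable along every divergent path of
finite length belongs to the little Bloch space. -/
theorem little_bloch_of_integrable_along_paths {F : ℂ → ℂ} (hF : DifferentiableOn ℂ F disk)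
    (hint : ∀ γ : ℝ → ℂ, IsDivergentPath γ → HasFiniteLength γ →
      IntegrableOn (fun t => ‖deriv F (γ t)‖ * ‖deriv γ t‖) (Ico 0 1))
    {δ : ℝ} (hδ : 0 < δ) :
    ∃ r < 1, ∀ w ∈ disk, r ≤ ‖w‖ → ‖deriv F w‖ * (1 - ‖w‖) ≤ δ := by
  by_contra! hcon
  choose! W hWd hWr hWδ using hcon
  have hk (k : ℕ) : knot k < 1 := knot_lt_one k
  obtain ⟨ζ, -, φ, hφ, hζ⟩ := (isCompact_closedBall (0 : ℂ) 1).tendsto_subseq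
    (x := fun k => W (knot k)) fun k => by simpa using (mem_disk.1 (hWd _ (hk k))).le
  have hζ1 : ‖ζ‖ = 1 := by
    refine tendsto_nhds_unique hζ.norm ?_
    refine tendsto_of_tendsto_of_tendsto_of_le_of_le (tendsto_knot.comp hφ.tendsto_atTop)
      tendsto_const_nhds (fun k => hWr _ (hk _)) fun k => (mem_disk.1 (hWd _ (hk _))).le
  -- Bad points accumulate at ζ on the unit circle; choosing them geometrically close to ζ will make
  -- the path's length finite.
  have hsel : ∀ n : ℕ, ∃ w ∈ disk, ‖w - ζ‖ < (1 / 4) ^ n ∧ δ < ‖deriv F w‖ * (1 - ‖w‖) := by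
    intro n
    obtain ⟨k, hk'⟩ := (hζ.eventually (Metric.ball_mem_nhds ζ
      (show (0 : ℝ) < (1 / 4) ^ n by positivity))).exists
    exact ⟨_, hWd _ (hk _), by simpa [dist_eq_norm] using hk', hWδ _ (hk _)⟩
  choose w hwd hwζ hwδ using hsel
  have hgap (n : ℕ) : 0 < 1 - ‖w n‖ := sub_pos.2 (mem_disk.1 (hwd n))
  have hball (n : ℕ) : Metric.closedBall (w n) ((1 - ‖w n‖) / 2) ⊆ disk := by
    intro z hz
    rw [Metric.mem_closedBall, dist_eq_norm] at hz
    have := norm_le_norm_add_norm_sub' z (w n)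
    rw [mem_disk]
    linarith [hgap n]
  -- Cauchy's estimate: an oscillation of at most δ/4 on this circle would give |F'(w)|(1 - |w|) ≤
  -- δ/2.
  have hz : ∀ n, ∃ z ∈ Metric.sphere (w n) ((1 - ‖w n‖) / 2), δ / 4 < ‖F z - F (w n)‖ := by
    intro n
    by_contra! hc
    have hd : DiffContOnCl ℂ (fun z => F z - F (w n)) (Metric.ball (w n) ((1 - ‖w n‖) / 2)) :=
      ((hF.mono (hball n)).sub_const _).diffContOnCl_ball subset_rfl
    have h1 := Complex.norm_deriv_le_of_forall_mem_sphere_norm_le (half_pos (hgap n)) hd hc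
    rw [deriv_sub_const, le_div_iff₀ (half_pos (hgap n))] at h1
    linarith [hwδ n]
  choose z hzs hzδ using hz
  have hzw (n : ℕ) : ‖z n - w n‖ = (1 - ‖w n‖) / 2 := by
    have := hzs n
    rwa [mem_sphere_iff_norm] at this
  have hzd (n : ℕ) : z n ∈ disk := hball n (Metric.sphere_subset_closedBall (hzs n))
  -- Interlacing w₀, z₀, w₁, z₁, … makes every even step change F by more than δ/4.
  set p : ℕ → ℂ := fun k => if Even k then w (k / 2) else z (k / 2) with hpdef
  have hpe (n : ℕ) : p (2 * n) = w n := by simp [hpdef]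
  have hpo (n : ℕ) : p (2 * n + 1) = z n := by
    have : (2 * n + 1) / 2 = n := by omega
    simp [hpdef, this]
  have hpd : ∀ k, p k ∈ disk := fun k => by
    rw [hpdef]; dsimp only; split_ifs
    · exact hwd _
    · exact hzd _
  -- The constant 3 comes from the odd terms: |z n - ζ| ≤ (3/2)|w n - ζ| < (3/2) 4⁻ⁿ = 3 ·
  -- 2^(-(2n+1)).
  have hpζ : ∀ k, ‖p k - ζ‖ ≤ 3 * (1 / 2) ^ k := by
    intro k
    obtain ⟨n, rfl | rfl⟩ := Nat.even_or_odd' k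
    · rw [hpe, pow_mul]
      have := hwζ n
      norm_num at this ⊢
      have h4 : (0 : ℝ) < (1 / 4) ^ n := by positivity
      linarith
    · rw [hpo, pow_succ, pow_mul]
      have h1 := hwζ n
      have h2 : 1 - ‖w n‖ ≤ ‖w n - ζ‖ := by
        have := norm_sub_norm_le ζ (w n)
        rw [hζ1, norm_sub_rev] at this
        exact this
      have h3 : ‖z n - ζ‖ ≤ ‖z n - w n‖ + ‖w n - ζ‖ := norm_sub_le_norm_sub_add_norm_sub _ _ _
      rw [hzw] at h3
      norm_num at h1 ⊢
      linarith
  have hgeo : Summable fun k : ℕ => (3 : ℝ) * (1 / 2) ^ k :=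
    (summable_geometric_of_lt_one (by norm_num) (by norm_num)).mul_left 3
  have hsum : Summable fun k => ‖p (k + 1) - p k‖ := by
    refine Summable.of_nonneg_of_le (fun k => norm_nonneg _) (fun k => ?_)
      (((summable_nat_add_iff 1).2 hgeo).add hgeo)
    have := norm_sub_le_norm_sub_add_norm_sub (p (k + 1)) ζ (p k)
    rw [norm_sub_rev ζ] at this
    exact this.trans (add_le_add (hpζ _) (hpζ _))
  have hpl : Tendsto p atTop (𝓝 ζ) := by
    rw [tendsto_iff_norm_sub_tendsto_zero]
    exact squeeze_zero (fun k => norm_nonneg _) hpζ hgeo.tendsto_atTop_zero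
  have hlim : Tendsto (fun k => ‖p k‖) atTop (𝓝 1) := hζ1 ▸ hpl.norm
  have hfin := tendsto_sub_of_integrable_along_paths hF hint hpd hsum hlim
  obtain ⟨N, hN⟩ := eventually_atTop.1 (hfin.eventually_lt_const (show 0 < δ / 4 by positivity))
  have h1 := hN (2 * N) (by omega)
  rw [hpe, hpo] at h1
  exact lt_asymm h1 (hzδ N)

/-! ### Expanding local diffeomorphisms of the disk are bijective. -/

section GlobalInverse

variable {k : ℂ → ℂ}

theorem exists_local_inverse {w : ℂ} {U : Set ℂ} (hU : IsOpen U) (hw : w ∈ U)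
    (hk : ContDiffAt ℝ ∞ k w) (hinj : Function.Injective (fderiv ℝ k w)) :
    ∃ e : OpenPartialHomeomorph ℂ ℂ, w ∈ e.source ∧ e.source ⊆ U ∧ (∀ z, e z = k z) ∧
      ContDiffAt ℝ ∞ e.symm (k w) := by
  set L : ℂ ≃L[ℝ] ℂ :=
    (LinearEquiv.ofInjectiveEndo (fderiv ℝ k w : ℂ →ₗ[ℝ] ℂ) hinj).toContinuousLinearEquiv
  have hL : HasFDerivAt k (L : ℂ →L[ℝ] ℂ) w := by
    refine (hk.differentiableAt (by simp)).hasFDerivAt.congr_fderiv ?_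
    ext v; rfl
  have hn : (∞ : WithTop ℕ∞) ≠ 0 := by simp
  refine ⟨(hk.toOpenPartialHomeomorph k hL hn).restrOpen U hU,
    ⟨hk.mem_toOpenPartialHomeomorph_source hL hn, hw⟩, fun z hz => hz.2, fun z => rfl, ?_⟩
  exact hk.to_localInverse hL hn

/-- The inverse of a smooth bijection between open sets with injective derivative is smooth. -/
theorem contDiffOn_invFunOn {U V : Set ℂ} (hU : IsOpen U) (hbij : BijOn k U V)
    (hk : ∀ w ∈ U, ContDiffAt ℝ ∞ k w) (hinj : ∀ w ∈ U, Function.Injective (fderiv ℝ k w)) :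
    ContDiffOn ℝ ∞ (Function.invFunOn k U) V := by
  intro z hz
  obtain ⟨w, hw, rfl⟩ := hbij.surjOn hz
  obtain ⟨e, hwe, heU, hek, hes⟩ := exists_local_inverse hU hw (hk w hw) (hinj w hw)
  refine (hes.congr_of_eventuallyEq ?_).contDiffWithinAt
  have : e.target ∈ 𝓝 (k w) := by
    rw [← hek]; exact e.open_target.mem_nhds (e.map_source hwe)
  filter_upwards [this] with y hy
  have h1 : e.symm y ∈ U := heU (e.map_target hy)
  have h2 : k (e.symm y) = y := by rw [← hek, e.right_inv hy]
  have h3 := hbij.invOn_invFunOn.1 h1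
  rwa [h2] at h3

/-- Local sections of a local diffeomorphism exist on balls of uniform size over compact sets. -/
theorem exists_uniform_local_section {K : Set ℂ} (hK : IsCompact K) (hKd : K ⊆ disk)
    (hk : ∀ w ∈ disk, ContDiffAt ℝ ∞ k w)
    (hinj : ∀ w ∈ disk, Function.Injective (fderiv ℝ k w)) :
    ∃ δ > 0, ∀ w ∈ K, ∃ g : ℂ → ℂ, ContinuousOn g (Metric.ball (k w) δ) ∧
      MapsTo g (Metric.ball (k w) δ) disk ∧ (∀ y ∈ Metric.ball (k w) δ, k (g y) = y) ∧
      g (k w) = w := by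
  refine hK.induction_on (p := fun s => ∃ δ > 0, ∀ w ∈ s, ∃ g : ℂ → ℂ,
      ContinuousOn g (Metric.ball (k w) δ) ∧
      MapsTo g (Metric.ball (k w) δ) disk ∧ (∀ y ∈ Metric.ball (k w) δ, k (g y) = y) ∧
      g (k w) = w) ⟨1, one_pos, by simp⟩ ?_ ?_ ?_
  · rintro s t hst ⟨δ, hδ, h⟩
    exact ⟨δ, hδ, fun w hw => h w (hst hw)⟩
  · rintro s t ⟨δ, hδ, h⟩ ⟨δ', hδ', h'⟩
    refine ⟨min δ δ', lt_min hδ hδ', ?_⟩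
    rintro w (hw | hw)
    · obtain ⟨g, h1, h2, h3, h4⟩ := h w hw
      have hb := Metric.ball_subset_ball (x := k w) (min_le_left δ δ')
      exact ⟨g, h1.mono hb, h2.mono_left hb, fun y hy => h3 y (hb hy), h4⟩
    · obtain ⟨g, h1, h2, h3, h4⟩ := h' w hw
      have hb := Metric.ball_subset_ball (x := k w) (min_le_right δ δ')
      exact ⟨g, h1.mono hb, h2.mono_left hb, fun y hy => h3 y (hb hy), h4⟩
  · intro x hx
    have hxd := hKd hx
    obtain ⟨e, hxe, hed, hek, -⟩ := exists_local_inverse isOpen_disk hxd (hk x hxd) (hinj x hxd)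
    have ht : e.target ∈ 𝓝 (k x) := by
      rw [← hek]; exact e.open_target.mem_nhds (e.map_source hxe)
    obtain ⟨ε, hε, hball⟩ := Metric.mem_nhds_iff.1 ht
    have hnear : ∀ᶠ w in 𝓝 x, w ∈ e.source ∧ k w ∈ Metric.ball (k x) (ε / 2) :=
      (e.open_source.eventually_mem hxe).and
        ((hk x hxd).continuousAt.eventually (Metric.ball_mem_nhds _ (half_pos hε)))
    -- Halving the radius lets one local inverse serve every centre `k w` within ε/2 of `k x`.
    refine ⟨_, mem_nhdsWithin_of_mem_nhds hnear, ε / 2, half_pos hε, fun w hw => ⟨e.symm, ?_⟩⟩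
    have hb : Metric.ball (k w) (ε / 2) ⊆ e.target := by
      refine Subset.trans (fun y hy => ?_) hball
      have h1 := Metric.mem_ball.1 hy
      have h2 := Metric.mem_ball.1 hw.2
      rw [Metric.mem_ball]
      linarith [dist_triangle y (k w) (k x)]
    refine ⟨e.continuousOn_symm.mono hb, fun y hy => hed (e.map_target (hb hy)), fun y hy => ?_, ?_⟩
    · rw [← hek, e.right_inv (hb hy)]
    · rw [← hek, e.left_inv hw.1]

/-- A continuous lift of a differentiable path under a local diffeomorphism is differentiable. -/
theorem exists_hasDerivAt_lift {γ β : ℝ → ℂ} {t : ℝ} {v : ℂ} (hγ : ContinuousAt γ t)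
    (hk : ContDiffAt ℝ ∞ k (γ t)) (hinj : Function.Injective (fderiv ℝ k (γ t)))
    (hlift : ∀ᶠ s in 𝓝 t, k (γ s) = β s) (hβ : HasDerivAt β v t) :
    ∃ v', HasDerivAt γ v' t ∧ fderiv ℝ k (γ t) v' = v := by
  obtain ⟨e, hte, -, hek, hes⟩ := exists_local_inverse isOpen_univ (mem_univ _) hk hinj
  have heq : γ =ᶠ[𝓝 t] fun s => e.symm (β s) := by
    filter_upwards [hlift, hγ.eventually (e.open_source.mem_nhds hte)] with s h1 h2
    rw [← h1, ← hek, e.left_inv h2]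
  rw [hlift.self_of_nhds] at hes
  have h1 := ((hes.differentiableAt (by simp)).hasFDerivAt.comp_hasDerivAt t hβ).congr_of_eventuallyEq
    heq
  refine ⟨_, h1, ?_⟩
  have h2 := ((hk.differentiableAt (by simp)).hasFDerivAt.comp_hasDerivAt t h1)
  exact (h2.congr_of_eventuallyEq (hlift.mono fun s hs => hs.symm)).unique hβ

/-- Lifts of a path with bounded hyperbolic speed stay in a fixed compact part of the disk. -/
theorem diskGap_lift_ge {c L T : ℝ} (hc : 0 < c) (hk : ∀ w ∈ disk, ContDiffAt ℝ ∞ k w)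
    (hinj : ∀ w ∈ disk, Function.Injective (fderiv ℝ k w))
    (hexp : ∀ w ∈ disk, ∀ v, c * hypFactor w * ‖v‖ ≤ hypFactor (k w) * ‖fderiv ℝ k w v‖)
    {γ β : ℝ → ℂ} {v : ℂ} (hβ : ∀ t, HasDerivAt β v t)
    (hL : ∀ t ∈ Icc 0 T, hypFactor (β t) * ‖v‖ ≤ c * L)
    (hγ : ContinuousOn γ (Icc 0 T)) (hγd : MapsTo γ (Icc 0 T) disk)
    (hlift : ∀ t ∈ Icc 0 T, k (γ t) = β t) {t : ℝ} (ht : t ∈ Icc 0 T) :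
    diskGap (γ 0) ≤ diskGap (γ t) * Real.exp (L * t) := by
  have hderiv : ∀ s ∈ Ioo 0 T, ∃ d, HasDerivAt (fun s => diskGap (γ s) * Real.exp (L * s)) d s
      ∧ 0 ≤ d := by
    intro s hs
    have hsI := Ioo_subset_Icc_self hs
    have hnhds : Icc 0 T ∈ 𝓝 s := Icc_mem_nhds hs.1 hs.2
    have hsd := hγd hsI
    obtain ⟨v', hv', hkv⟩ := exists_hasDerivAt_lift (hγ.continuousAt hnhds) (hk _ hsd) (hinj _ hsd)
      (by filter_upwards [hnhds] with r hr using hlift r hr) (hβ s)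
    have h1 := hexp _ hsd v'
    rw [hkv, hlift s hsI] at h1
    have h2 := h1.trans (hL s hsI)
    -- Cancelling c leaves 2|v'| ≤ L (1 - |γ|²), the differential inequality behind the Grönwall
    -- factor exp(L t).
    rw [mul_assoc, mul_le_mul_iff_of_pos_left hc, hypFactor_eq, div_mul_eq_mul_div,
      div_le_iff₀ (diskGap_pos hsd)] at h2
    have h3 : HasDerivAt (fun s => diskGap (γ s)) (-(2 * inner ℝ (γ s) v')) s := by
      have := (hv'.norm_sq).const_sub 1
      simpa [diskGap] using this
    have h4 : HasDerivAt (fun s => Real.exp (L * s)) (Real.exp (L * s) * L) s := by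
      simpa using ((hasDerivAt_id s).const_mul L).exp
    refine ⟨_, h3.mul h4, ?_⟩
    have h5 : inner ℝ (γ s) v' ≤ ‖v'‖ := by
      refine (real_inner_le_norm _ _).trans ?_
      exact mul_le_of_le_one_left (norm_nonneg _) (mem_disk.1 hsd).le
    have h6 := Real.exp_pos (L * s)
    have : -(2 * inner ℝ (γ s) v') * Real.exp (L * s) + diskGap (γ s) * (Real.exp (L * s) * L)
      = (L * diskGap (γ s) - 2 * inner ℝ (γ s) v') * Real.exp (L * s) := by ring
    rw [this]
    exact mul_nonneg (by linarith) h6.le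
  have hmono : MonotoneOn (fun s => diskGap (γ s) * Real.exp (L * s)) (Icc 0 T) := by
    refine monotoneOn_of_deriv_nonneg (convex_Icc 0 T) ?_ ?_ ?_
    · exact (continuous_diskGap.comp_continuousOn hγ).mul (by fun_prop)
    · rw [interior_Icc]
      intro s hs
      obtain ⟨d, hd, -⟩ := hderiv s hs
      exact hd.differentiableAt.differentiableWithinAt
    · rw [interior_Icc]
      intro s hs
      obtain ⟨d, hd, h0⟩ := hderiv s hs
      rwa [hd.deriv]
  simpa using hmono ⟨le_rfl, ht.1.trans ht.2⟩ ht ht.1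

/-- Segments lift under a local diffeomorphism of the disk that expands the hyperbolic metric by a
definite factor. -/
theorem exists_segment_lift {c : ℝ} (hc : 0 < c) (hk : ∀ w ∈ disk, ContDiffAt ℝ ∞ k w)
    (hmaps : MapsTo k disk disk)
    (hinj : ∀ w ∈ disk, Function.Injective (fderiv ℝ k w))
    (hexp : ∀ w ∈ disk, ∀ v, c * hypFactor w * ‖v‖ ≤ hypFactor (k w) * ‖fderiv ℝ k w v‖)
    {w₀ z : ℂ} (hw₀ : w₀ ∈ disk) (hz : z ∈ disk) :
    ∃ γ : ℝ → ℂ, ContinuousOn γ (Icc 0 1) ∧ MapsTo γ (Icc 0 1) disk ∧ γ 0 = w₀ ∧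
      ∀ t ∈ Icc (0 : ℝ) 1, k (γ t) = k w₀ + t • (z - k w₀) := by
  set v := z - k w₀ with hv
  set β : ℝ → ℂ := fun t => k w₀ + t • v with hβdef
  have hβ : ∀ t, HasDerivAt β v t := fun t => by
    have := ((hasDerivAt_id t).smul_const v).const_add (k w₀)
    rwa [one_smul] at this
  have hβc : Continuous β := by fun_prop
  have hβd : MapsTo β (Icc 0 1) disk := fun t ht =>
    (convex_ball (0 : ℂ) 1).add_smul_sub_mem (hmaps hw₀) hz ht
  obtain ⟨C, hC⟩ := isCompact_Icc.exists_bound_of_continuousOn (s := Icc (0 : ℝ) 1)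
    (f := fun t => hypFactor (β t) * ‖v‖) (by
      simp only [hypFactor_eq]
      exact ((continuousOn_const.div (continuous_diskGap.comp hβc).continuousOn
        fun t ht => (diskGap_pos (hβd ht)).ne').mul continuousOn_const))
  set L := C / c with hLdef
  have hL : ∀ t ∈ Icc (0 : ℝ) 1, hypFactor (β t) * ‖v‖ ≤ c * L := fun t ht => by
    rw [hLdef, mul_div_cancel₀ _ hc.ne']
    exact (le_abs_self _).trans (hC t ht)
  have hL0 : 0 ≤ L := by
    have h0 : (0 : ℝ) ∈ Icc (0 : ℝ) 1 := ⟨le_rfl, zero_le_one⟩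
    have := (norm_nonneg _).trans (hC 0 h0)
    positivity
  -- By `diskGap_lift_ge`, no partial lift can leave the compact set `diskGap ≥ η`, so one radius δ
  -- serves all extensions.
  set η := diskGap w₀ * Real.exp (-L) with hη
  have hη0 : 0 < η := mul_pos (diskGap_pos hw₀) (Real.exp_pos _)
  set K : Set ℂ := {w | η ≤ diskGap w} with hKdef
  have hKd : K ⊆ disk := by
    intro w hw
    have : 0 < diskGap w := hη0.trans_le hw
    unfold diskGap at this
    rw [mem_disk]
    nlinarith [norm_nonneg w]
  have hK : IsCompact K := by
    refine (isCompact_closedBall (0 : ℂ) 1).of_isClosed_subset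
      (isClosed_le continuous_const continuous_diskGap) fun w hw => ?_
    simpa using (mem_disk.1 (hKd hw)).le
  obtain ⟨δ, hδ, hsec⟩ := exists_uniform_local_section hK hKd hk hinj
  -- In time τ the segment moves by less than δ; the +1 covers v = 0.
  set τ := δ / (‖v‖ + 1) with hτ
  have hτ0 : 0 < τ := by positivity
  have hτv : τ * ‖v‖ < δ := by
    rw [hτ, div_mul_eq_mul_div, div_lt_iff₀ (by positivity)]
    nlinarith
  have hstep : ∀ n : ℕ, ∃ γ : ℝ → ℂ, ContinuousOn γ (Icc 0 (min (n * τ) 1)) ∧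
      MapsTo γ (Icc 0 (min (n * τ) 1)) disk ∧ γ 0 = w₀ ∧
      ∀ t ∈ Icc (0 : ℝ) (min (n * τ) 1), k (γ t) = β t := by
    intro n
    induction n with
    | zero =>
      refine ⟨fun _ => w₀, continuousOn_const, fun _ _ => hw₀, rfl, fun t ht => ?_⟩
      have h1 : t = 0 := by
        have := ht.2
        simp only [Nat.cast_zero, zero_mul, zero_le_one, inf_of_le_left] at this
        exact le_antisymm this ht.1
      simp [h1, hβdef]
    | succ n ih =>
      obtain ⟨γ, hγc, hγd, hγ0, hγl⟩ := ih
      set T := min (n * τ) 1 with hT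
      set T' := min (((n + 1 : ℕ) : ℝ) * τ) 1 with hT'
      have hT0 : 0 ≤ T := le_min (by positivity) zero_le_one
      have hT1 : T ≤ 1 := min_le_right _ _
      have hT'1 : T' ≤ 1 := min_le_right _ _
      have hTT' : T' ≤ T + τ := by
        have h1 : T' ≤ (n + 1) * τ := by
          have : T' ≤ ((n + 1 : ℕ) : ℝ) * τ := min_le_left _ _
          rwa [Nat.cast_succ] at this
        rcases min_choice (n * τ) 1 with h | h
        · rw [hT, h]; linarith
        · rw [hT, h]; linarith
      have hTmem : T ∈ Icc 0 T := ⟨hT0, le_rfl⟩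
      have hTK : γ T ∈ K := by
        have h1 := diskGap_lift_ge hc hk hinj hexp hβ
          (fun t ht => hL t ⟨ht.1, ht.2.trans hT1⟩) hγc hγd hγl hTmem
        rw [hγ0] at h1
        have h2 : Real.exp (L * T) ≤ Real.exp L := Real.exp_le_exp.2 (by nlinarith)
        have h3 := diskGap_pos (hγd hTmem)
        change η ≤ _
        rw [hη, Real.exp_neg, ← div_eq_mul_inv, div_le_iff₀ (Real.exp_pos _)]
        nlinarith
      obtain ⟨g, hgc, hgd, hgs, hgk⟩ := hsec _ hTK
      rw [hγl T hTmem] at hgc hgd hgs hgk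
      have hball : ∀ t ∈ Icc T T', β t ∈ Metric.ball (β T) δ := by
        intro t ht
        rw [Metric.mem_ball, dist_eq_norm]
        have : β t - β T = (t - T) • v := by simp only [hβdef, sub_smul]; ring
        rw [this, norm_smul, Real.norm_of_nonneg (sub_nonneg.2 ht.1)]
        refine lt_of_le_of_lt ?_ hτv
        gcongr
        linarith [ht.2]
      refine ⟨fun t => if t ≤ T then γ t else g (β t), ?_, ?_, ?_, ?_⟩
      · refine ContinuousOn.if ?_ ?_ ?_
        · rintro t ⟨-, ht⟩
          have : t = T := by
            have := frontier_le_subset_eq continuous_id continuous_const ht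
            exact this
          rw [this, hgk]
        · refine hγc.mono fun t ht => ⟨ht.1.1, ?_⟩
          have := closure_le_eq (f := id) (g := fun _ : ℝ => T) continuous_id continuous_const
          have h1 := ht.2
          change t ∈ closure {b | id b ≤ T} at h1
          rw [this] at h1
          exact h1
        · refine hgc.comp hβc.continuousOn fun t ht => hball t ⟨?_, ht.1.2⟩
          have h1 := ht.2
          simp only [not_le] at h1
          exact closure_lt_subset_le continuous_const continuous_id h1
      · intro t ht
        dsimp only
        split_ifs with h
        · exact hγd ⟨ht.1, h⟩
        · exact hgd (hball t ⟨(not_le.1 h).le, ht.2⟩)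
      · simp [hT0, hγ0]
      · intro t ht
        dsimp only
        split_ifs with h
        · exact hγl t ⟨ht.1, h⟩
        · exact hgs _ (hball t ⟨(not_le.1 h).le, ht.2⟩)
  obtain ⟨n, hn⟩ := exists_nat_gt (1 / τ)
  have : min (n * τ) 1 = 1 := min_eq_right (by rw [div_lt_iff₀ hτ0] at hn; exact hn.le)
  obtain ⟨γ, h⟩ := hstep n
  rw [this] at h
  exact ⟨γ, h⟩

theorem isLocalHomeomorph_restrict_disk (hk : ∀ w ∈ disk, ContDiffAt ℝ ∞ k w)
    (hmaps : MapsTo k disk disk) (hinj : ∀ w ∈ disk, Function.Injective (fderiv ℝ k w)) :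
    IsLocalHomeomorph (hmaps.restrict k disk disk) := by
  have hval : IsLocalHomeomorph (Subtype.val : disk → ℂ) :=
    (isOpen_disk.isOpenEmbedding_subtypeVal).isLocalHomeomorph
  have hcont : ContinuousOn k disk := fun w hw => (hk w hw).continuousAt.continuousWithinAt
  refine IsLocalHomeomorph.of_comp ?_ hval (hcont.mapsToRestrict hmaps)
  have hloc : IsLocalHomeomorphOn k disk := by
    refine IsLocalHomeomorphOn.mk k disk fun w hw => ?_
    obtain ⟨e, hwe, -, hek, -⟩ := exists_local_inverse isOpen_disk hw (hk w hw) (hinj w hw)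
    exact ⟨e, hwe, fun z _ => (hek z).symm⟩
  rw [isLocalHomeomorph_iff_isLocalHomeomorphOn_univ]
  exact hloc.comp (isLocalHomeomorph_iff_isLocalHomeomorphOn_univ.1 hval) fun x _ => x.2

/-- A smooth self-map of the disk that expands the hyperbolic metric by a definite factor is
bijective. -/
theorem bijOn_disk_of_expanding {c : ℝ} (hc : 0 < c) (hk : ∀ w ∈ disk, ContDiffAt ℝ ∞ k w)
    (hmaps : MapsTo k disk disk)
    (hinj : ∀ w ∈ disk, Function.Injective (fderiv ℝ k w))
    (hexp : ∀ w ∈ disk, ∀ v, c * hypFactor w * ‖v‖ ≤ hypFactor (k w) * ‖fderiv ℝ k w v‖) :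
    BijOn k disk disk := by
  have h0 : (0 : ℂ) ∈ disk := by simp [mem_disk]
  set kd := hmaps.restrict k disk disk with hkd
  have hloc : IsLocalHomeomorph kd := isLocalHomeomorph_restrict_disk hk hmaps hinj
  choose Γ hΓc hΓd hΓ0 hΓl using fun z : disk => exists_segment_lift hc hk hmaps hinj hexp h0 z.2
  let f : C(unitInterval × disk, disk) :=
    { toFun := fun x => ⟨k 0 + (x.1 : ℝ) • ((x.2 : ℂ) - k 0),
        (convex_ball (0 : ℂ) 1).add_smul_sub_mem (hmaps h0) x.2.2 x.1.2⟩
      continuous_toFun := by fun_prop }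
  let g : unitInterval × disk → disk := fun x => ⟨Γ x.2 x.1, hΓd x.2 x.1.2⟩
  -- The lifts were chosen separately for each endpoint; uniqueness of lifts makes them jointly
  -- continuous.
  have hg : Continuous g := by
    refine hloc.continuous_lift (T2Space.isSeparatedMap kd) f ?_ ?_ ?_
    · funext x
      exact Subtype.ext (hΓl x.2 x.1 x.1.2)
    · have : (fun z : disk => g (0, z)) = fun _ => ⟨0, h0⟩ := by
        funext z; exact Subtype.ext (hΓ0 z)
      rw [this]; exact continuous_const
    · intro z
      exact Continuous.subtype_mk (continuousOn_iff_continuous_domRestrict.1 (hΓc z)) _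
  let G : disk → disk := fun z => g (1, z)
  have hG : Continuous G := hg.comp (by fun_prop)
  have hkG : ∀ z, kd (G z) = z := by
    intro z
    refine Subtype.ext ?_
    refine (hΓl z 1 ⟨zero_le_one, le_rfl⟩).trans ?_
    rw [one_smul, add_sub_cancel]
  have hGloc : IsLocalHomeomorph G := by
    refine IsLocalHomeomorph.of_comp ?_ hloc hG
    have : kd ∘ G = id := funext hkG
    rw [this]; exact (Homeomorph.refl _).isLocalHomeomorph
  -- The image of a continuous section is closed, and open because the section is a local
  -- homeomorphism. By connectedness it is the whole disk, so the map is injective.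
  have hclosed : IsClosed (range G) := by
    have : range G = {x | G (kd x) = x} := by
      ext x
      constructor
      · rintro ⟨z, rfl⟩; simp [hkG]
      · intro hx; exact ⟨kd x, hx⟩
    rw [this]
    exact isClosed_eq (hG.comp hloc.continuous) continuous_id
  have : PreconnectedSpace disk :=
    isPreconnected_iff_preconnectedSpace.1 (convex_ball (0 : ℂ) 1).isPreconnected
  have huniv : range G = univ := by
    refine IsClopen.eq_univ ⟨hclosed, hGloc.isOpenMap.isOpen_range⟩ ⟨_, mem_range_self ⟨0, h0⟩⟩
  refine ⟨hmaps, ?_, ?_⟩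
  · intro x hx y hy hxy
    obtain ⟨a, ha⟩ : (⟨x, hx⟩ : disk) ∈ range G := huniv ▸ mem_univ _
    obtain ⟨b, hb⟩ : (⟨y, hy⟩ : disk) ∈ range G := huniv ▸ mem_univ _
    have h1 : kd ⟨x, hx⟩ = kd ⟨y, hy⟩ := Subtype.ext hxy
    rw [← ha, ← hb, hkG, hkG] at h1
    rw [h1, hb] at ha
    exact (congrArg Subtype.val ha).symm
  · intro z hz
    exact ⟨G ⟨z, hz⟩, (G ⟨z, hz⟩).2, congrArg Subtype.val (hkG ⟨z, hz⟩)⟩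

end GlobalInverse

/-! ### Harmonic diffeomorphisms of either orientation. -/

section Orientation

/-- If p = h_w and b = h_w̄ had equal norms, both p̄ - b and i(p̄ + b) would lie in the kernel of
dh; their vanishing gives p = b = 0 and dh = 0. -/
theorem norm_wirt_ne_of_injective {h : ℂ → ℂ} {w : ℂ}
    (hinj : Function.Injective (fderiv ℝ h w)) : ‖wirt h w‖ ≠ ‖wirtBar h w‖ := by
  intro heq
  have hker : ∀ v, wirt h w * v + wirtBar h w * conj v = 0 → v = 0 := by
    intro v hv
    rw [← fderiv_apply_wirt] at hv
    exact hinj (by rw [hv, map_zero])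
  have h0 : wirt h w * conj (wirt h w) = wirtBar h w * conj (wirtBar h w) := by
    rw [Complex.mul_conj', Complex.mul_conj', heq]
  have h1 := hker (conj (wirt h w) - wirtBar h w) (by
    simp only [map_sub, Complex.conj_conj]; linear_combination h0)
  have h2 := hker (conj (wirt h w) * Complex.I + wirtBar h w * Complex.I) (by
    simp only [map_add, map_mul, Complex.conj_conj, Complex.conj_I]
    linear_combination Complex.I * h0)
  have h3 : wirtBar h w = 0 := by
    have : 2 * Complex.I * wirtBar h w = 0 := by linear_combination h2 - Complex.I * h1
    simpa using this
  have h4 : wirt h w = 0 := by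
    rw [h3, norm_zero, norm_eq_zero] at heq; exact heq
  exact one_ne_zero (hker 1 (by rw [h3, h4]; ring))

theorem diskGap_conj (z : ℂ) : diskGap (conj z) = diskGap z := by simp [diskGap]

theorem diskConn_conj (z : ℂ) : diskConn (conj z) = conj (diskConn z) := by
  simp [diskConn, diskGap_conj]

/-- A harmonic diffeomorphism of the disk expands the hyperbolic metric by a definite factor in its
most expanded direction. -/
theorem harmonic_diffeo_expanding_bound {h : ℂ → ℂ} (hbij : BijOn h disk disk)
    (hs : ∀ z ∈ disk, ContDiffAt ℝ ∞ h z) (hinj : ∀ z ∈ disk, Function.Injective (fderiv ℝ h z))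
    (hh : ∀ z ∈ disk, wirtBar (wirt h) z = -2 * diskConn (h z) * wirt h z * wirtBar h z)
    {w : ℂ} (hw : w ∈ disk) :
    diskGap (h w) ^ 2 ≤ 6 * diskGap w ^ 2 * max ‖wirt h w‖ ‖wirtBar h w‖ ^ 2 := by
  have hcpt : ∀ ε > 0, IsCompact {z | z ∈ disk ∧ ε ≤ diskGap (h z)} := by
    intro ε hε
    have hsub : {z | ε ≤ diskGap z} ⊆ disk := by
      intro z hz
      have : 0 < diskGap z := hε.trans_le hz
      unfold diskGap at this
      rw [mem_disk]
      nlinarith [norm_nonneg z]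
    have hc : IsCompact {z | ε ≤ diskGap z} :=
      (isCompact_closedBall (0 : ℂ) 1).of_isClosed_subset
        (isClosed_le continuous_const continuous_diskGap) fun z hz => by
          simpa using (mem_disk.1 (hsub hz)).le
    have himg := hc.image_of_continuousOn
      ((contDiffOn_invFunOn isOpen_disk hbij hs hinj).continuousOn.mono hsub)
    convert himg using 1
    ext z
    constructor
    · rintro ⟨hz, hzε⟩
      exact ⟨h z, hzε, hbij.invOn_invFunOn.1 hz⟩
    · rintro ⟨y, hy, rfl⟩
      refine ⟨hbij.surjOn.mapsTo_invFunOn (hsub hy), ?_⟩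
      rw [hbij.invOn_invFunOn.2 (hsub hy)]
      exact hy
  have hne : ∀ z ∈ disk, ‖wirt h z‖ - ‖wirtBar h z‖ ≠ 0 := fun z hz =>
    sub_ne_zero.2 (norm_wirt_ne_of_injective (hinj z hz))
  have hcont : ContinuousOn (fun z => ‖wirt h z‖ - ‖wirtBar h z‖) disk := fun z hz =>
    ((wirt_contDiffAt (hs z hz)).continuousAt.norm.sub
      (wirtBar_contDiffAt (hs z hz)).continuousAt.norm).continuousWithinAt
  have hconn : IsPreconnected disk := (convex_ball (0 : ℂ) 1).isPreconnected
  have hY := (diskGap_pos hw).le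
  rcases lt_or_gt_of_ne (hne w hw) with hlt | hgt
  · have hall : ∀ z ∈ disk, ‖wirt h z‖ - ‖wirtBar h z‖ < 0 := by
      intro z hz
      by_contra! hc
      obtain ⟨y, hy, hy0⟩ := hconn.intermediate_value hw hz hcont ⟨hlt.le, hc⟩
      exact hne y hy hy0
    -- In the orientation-reversing case the bound is applied to the conjugate of h, again harmonic
    -- because conjugation is a hyperbolic isometry.
    have hk (z : ℂ) (hz : z ∈ disk) : HasWirt (fun z => conj (h z)) (conj (wirtBar h z))
      (conj (wirt h z)) z := ((hs z hz).differentiableAt (by simp)).hasWirt.star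
    have hb := harmonic_expanding_bound (h := fun z => conj (h z)) (w := w)
      (fun z hz => by
        have := hbij.mapsTo hz
        rw [mem_disk] at this ⊢
        simpa using this)
      (fun z hz => (Complex.conjCLE : ℂ →L[ℝ] ℂ).contDiff.contDiffAt.comp z (hs z hz))
      (fun z hz => by
        have h1 : wirt (fun z => conj (h z)) =ᶠ[𝓝 z] fun z => conj (wirtBar h z) := by
          filter_upwards [isOpen_disk.mem_nhds hz] with y hy using (hk y hy).wirt_eq
        have h2 := ((wirtBar_contDiffAt (hs z hz)).differentiableAt (by simp)).hasWirt.star.congr h1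
        rw [h2.wirtBar_eq, wirt_wirtBar_comm (hs z hz), hh z hz, (hk z hz).wirt_eq,
          (hk z hz).wirtBar_eq, diskConn_conj]
        simp only [map_mul, map_neg, map_ofNat]
        ring)
      (fun z hz => by
        rw [(hk z hz).wirt_eq, (hk z hz).wirtBar_eq, RCLike.norm_conj, RCLike.norm_conj]
        linarith [hall z hz])
      (by simpa only [diskGap_conj] using hcpt) hw
    rw [diskGap_conj, (hk w hw).wirt_eq, RCLike.norm_conj] at hb
    refine hb.trans ?_
    gcongr
    exact le_max_right _ _
  · have hall : ∀ z ∈ disk, 0 < ‖wirt h z‖ - ‖wirtBar h z‖ := by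
      intro z hz
      by_contra! hc
      obtain ⟨y, hy, hy0⟩ := hconn.intermediate_value hz hw hcont ⟨hc, hgt.le⟩
      exact hne y hy hy0
    refine (harmonic_expanding_bound hbij.mapsTo hs hh (fun z hz => sub_pos.1 (hall z hz))
      hcpt hw).trans ?_
    gcongr
    exact le_max_left _ _

end Orientation

/-! ### Entire graphs and their horizontal projections. -/

namespace IsConformalMinimalImmersion

variable {h : ℂ → ℂ} {f : ℂ → ℝ}

/-- The horizontal projection of an entire graph is a diffeomorphism of the disk. -/
theorem bijOn_and_injective_of_isEntireGraph (hX : IsConformalMinimalImmersion h f)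
    (hgraph : IsEntireGraph h f) :
    BijOn h disk disk ∧ ∀ w ∈ disk, Function.Injective (fderiv ℝ h w) := by
  obtain ⟨hinj, u, hu, himg⟩ := hgraph
  have hfu : ∀ w ∈ disk, f w = u (h w) := by
    intro w hw
    have : (h w, f w) ∈ (fun w => (h w, f w)) '' disk := mem_image_of_mem _ hw
    rw [himg] at this
    exact this.2
  refine ⟨⟨hX.mapsTo, ?_, ?_⟩, ?_⟩
  · intro x hx y hy hxy
    exact hinj hx hy (Prod.ext hxy (by simp only [hfu x hx, hfu y hy, hxy]))
  · intro z hz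
    have : (z, u z) ∈ {p : ℂ × ℝ | p.1 ∈ disk ∧ p.2 = u p.1} := ⟨hz, rfl⟩
    rw [← himg] at this
    obtain ⟨w, hw, hwz⟩ := this
    exact ⟨w, hw, congrArg Prod.fst hwz⟩
  · intro w hw
    rw [injective_iff_map_eq_zero]
    intro v hv
    have hud : DifferentiableAt ℝ u (h w) :=
      (hu.contDiffAt (isOpen_disk.mem_nhds (hX.mapsTo hw))).differentiableAt (by simp)
    -- Since f = u ∘ h, a kernel vector of dh is also killed by df, so conformality makes it zero.
    have hf : HasFDerivAt f ((fderiv ℝ u (h w)).comp (fderiv ℝ h w)) w := by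
      refine (hud.hasFDerivAt.comp w
        (hX.differentiableAt_fst hw).hasFDerivAt).congr_of_eventuallyEq ?_
      filter_upwards [isOpen_disk.mem_nhds hw] with z hz using hfu z hz
    obtain ⟨l, hl, hform⟩ := hX.conformal w hw
    have h1 := hform v v
    simp only [firstForm, hf.fderiv, ContinuousLinearMap.comp_apply, hv, map_zero, inner_zero_left,
      mul_zero, add_zero, real_inner_self_eq_norm_sq] at h1
    have h2 : ‖v‖ ^ 2 = 0 := by
      rcases mul_eq_zero.1 h1.symm with h | h
      · exact absurd h (by positivity)
      · exact h
    simpa using h2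

theorem isEntireGraph_of_bijOn (hX : IsConformalMinimalImmersion h f) (hbij : BijOn h disk disk)
    (hinj : ∀ w ∈ disk, Function.Injective (fderiv ℝ h w)) : IsEntireGraph h f := by
  have hg := contDiffOn_invFunOn isOpen_disk hbij (fun w hw => hX.contDiffAt_fst hw) hinj
  have hgd := hbij.surjOn.mapsTo_invFunOn
  refine ⟨fun x hx y hy hxy => hbij.injOn hx hy (congrArg Prod.fst hxy),
    fun z => f (Function.invFunOn h disk z), hX.smooth_snd.comp hg hgd, ?_⟩
  ext ⟨z, t⟩
  constructor
  · rintro ⟨w, hw, hwz⟩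
    obtain ⟨rfl, rfl⟩ := Prod.mk.inj hwz
    refine ⟨hX.mapsTo hw, ?_⟩
    dsimp only
    rw [hbij.invOn_invFunOn.1 hw]
  · rintro ⟨hz, ht⟩
    dsimp only at hz ht
    exact ⟨Function.invFunOn h disk z, hgd hz, Prod.ext (hbij.invOn_invFunOn.2 hz) ht.symm⟩

/-- The Hopf differential decays relative to the hyperbolic metric of the parameter disk. -/
theorem norm_hopf_le (hX : IsConformalMinimalImmersion h f)
    (hint : ∀ γ : ℝ → ℂ, IsDivergentPath γ → HasFiniteLength γ →
      IntegrableOn (fun t => ‖hopf h (γ t)‖ ^ (1 / 2 : ℝ) * ‖deriv γ t‖) (Ico 0 1)) :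
    ∃ r < 1, ∀ w ∈ disk, r ≤ ‖w‖ → ‖hopf h w‖ ≤ hypFactor w ^ 2 / 16 := by
  obtain ⟨F, hF, hFh⟩ := hX.exists_holomorphic
  obtain ⟨r, hr, hrw⟩ := little_bloch_of_integrable_along_paths hF (δ := 1 / 2) (by
    intro γ hγ hγl
    refine IntegrableOn.congr_fun ((hint γ hγ hγl).const_mul 2) (fun t ht => ?_) measurableSet_Ico
    rw [hFh _ (hγ.mapsTo ht), ← Real.sqrt_eq_rpow, Real.sqrt_sq (by positivity)]
    ring) (by norm_num)
  refine ⟨r, hr, fun w hw hwr => ?_⟩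
  have h1 := hrw w hw hwr
  have hg := diskGap_pos hw
  rw [hFh w hw, hypFactor_eq]
  have h2 : ‖deriv F w‖ / 2 ≤ (2 / diskGap w) / 4 := by
    rw [div_div, div_le_div_iff₀ two_pos (by positivity)]
    have h3 : diskGap w ≤ 2 * (1 - ‖w‖) := by
      have := mem_disk.1 hw
      unfold diskGap
      nlinarith [norm_nonneg w]
    nlinarith [norm_nonneg (deriv F w)]
  calc _ ≤ ((2 / diskGap w) / 4) ^ 2 := by gcongr
    _ = _ := by ring

/-- The horizontal projection of an entire graph whose Hopf differential decays expands the
hyperbolic metric by a definite factor in all directions. -/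
theorem exists_expanding_factor (hX : IsConformalMinimalImmersion h f)
    (hgraph : IsEntireGraph h f) {r : ℝ} (hr : r < 1)
    (hφ : ∀ w ∈ disk, r ≤ ‖w‖ → ‖hopf h w‖ ≤ hypFactor w ^ 2 / 16) :
    ∃ c > 0, ∀ w ∈ disk,
      c * hypFactor w ≤ hypFactor (h w) * |‖wirt h w‖ - ‖wirtBar h w‖| := by
  obtain ⟨hbij, hinj⟩ := hX.bijOn_and_injective_of_isEntireGraph hgraph
  have hs : ∀ w ∈ disk, ContDiffAt ℝ ∞ h w := fun w hw => hX.contDiffAt_fst hw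
  have houter : ∀ w ∈ disk, r ≤ ‖w‖ →
      1 / 5 * hypFactor w ≤ hypFactor (h w) * |‖wirt h w‖ - ‖wirtBar h w‖| := by
    intro w hw hwr
    have h1 := harmonic_diffeo_expanding_bound hbij hs hinj (fun z hz => hX.harmonic_eq hz) hw
    have h2 := hφ w hw hwr
    rw [norm_hopf (hX.differentiableAt_fst hw), ← max_mul_min ‖wirt h w‖] at h2
    rw [← max_sub_min_eq_abs']
    have hM : 0 ≤ max ‖wirt h w‖ ‖wirtBar h w‖ := le_max_of_le_left (norm_nonneg _)
    have hm : 0 ≤ min ‖wirt h w‖ ‖wirtBar h w‖ := le_min (norm_nonneg _) (norm_nonneg _)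
    generalize max ‖wirt h w‖ ‖wirtBar h w‖ = M at *
    generalize min ‖wirt h w‖ ‖wirtBar h w‖ = m at *
    have hσ := hypFactor_pos hw
    have hs0 := hypFactor_pos (hX.mapsTo hw)
    have h3 : hypFactor w ^ 2 ≤ 6 * (hypFactor (h w) * M) ^ 2 := by
      rw [hypFactor_eq, hypFactor_eq]
      have hg := diskGap_pos hw
      have hY := diskGap_pos (hX.mapsTo hw)
      rw [div_pow, div_mul_eq_mul_div, div_pow, mul_div_assoc', div_le_div_iff₀ (by positivity)
        (by positivity)]
      nlinarith
    have h4 : (hypFactor (h w) * M) * (hypFactor (h w) * m) ≤ hypFactor w ^ 2 / 16 := by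
      linarith
    rw [mul_sub]
    have h5 : 0 ≤ hypFactor (h w) * M := by positivity
    have h6 : 0 ≤ hypFactor (h w) * m := by positivity
    generalize hypFactor (h w) * M = x at *
    generalize hypFactor (h w) * m = y at *
    generalize hypFactor w = σ at *
    by_contra! hc
    have h7 : x * (x - y) ≤ x * (1 / 5 * σ) := by gcongr
    -- For x ≤ σ/2, x(x - y) ≥ (1/6 - 1/16)σ² = 5σ²/48 exceeds xσ/5 ≤ σ²/10. For x > σ/2, y ≤ σ/8
    -- and so x - y > 3σ/8.
    rcases le_or_gt x (σ / 2) with hx | hx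
    · nlinarith
    · have : y ≤ σ / 8 := by
        by_contra! hy
        nlinarith
      linarith
  set R := max r 0 with hR
  have hR1 : R < 1 := max_lt hr one_pos
  have hball : Metric.closedBall (0 : ℂ) R ⊆ disk := Metric.closedBall_subset_ball hR1
  have hcont : ContinuousOn (fun w => hypFactor (h w) * |‖wirt h w‖ - ‖wirtBar h w‖|
      / hypFactor w) (Metric.closedBall (0 : ℂ) R) := by
    refine ContinuousOn.mono (fun w hw => ContinuousAt.continuousWithinAt ?_) hball
    have hY := (diskGap_pos (hX.mapsTo hw)).ne'
    have hg := (diskGap_pos hw).ne'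
    have c1 : ContinuousAt (fun w => hypFactor (h w)) w := by
      simp only [hypFactor_eq]
      exact continuousAt_const.div
        (continuous_diskGap.continuousAt.comp (hs w hw).continuousAt) hY
    have c2 : ContinuousAt hypFactor w := by
      change ContinuousAt (fun z => 2 / diskGap z) w
      exact continuousAt_const.div continuous_diskGap.continuousAt hg
    exact (c1.mul ((wirt_contDiffAt (hs w hw)).continuousAt.norm.sub
      (wirtBar_contDiffAt (hs w hw)).continuousAt.norm).abs).div c2 (hypFactor_pos hw).ne'
  obtain ⟨m, hm, hmin⟩ := (isCompact_closedBall (0 : ℂ) R).exists_isMinOn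
    ⟨0, by simp [hR]⟩ hcont
  have hmd := hball hm
  set c₀ := hypFactor (h m) * |‖wirt h m‖ - ‖wirtBar h m‖| / hypFactor m with hc₀
  have hc₀pos : 0 < c₀ := div_pos (mul_pos (hypFactor_pos (hX.mapsTo hmd))
    (abs_pos.2 (sub_ne_zero.2 (norm_wirt_ne_of_injective (hinj m hmd))))) (hypFactor_pos hmd)
  refine ⟨min c₀ (1 / 5), lt_min hc₀pos (by norm_num), fun w hw => ?_⟩
  have hσ := hypFactor_pos hw
  rcases le_or_gt r ‖w‖ with hwr | hwr
  · refine le_trans ?_ (houter w hw hwr)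
    gcongr
    exact min_le_right _ _
  · have h1 : c₀ ≤ _ := hmin (show w ∈ Metric.closedBall (0 : ℂ) R by
      rw [mem_closedBall_zero_iff]; exact hwr.le.trans (le_max_left r 0))
    dsimp only at h1
    rw [le_div_iff₀ hσ] at h1
    refine le_trans ?_ h1
    gcongr
    exact min_le_left _ _

end IsConformalMinimalImmersion

/-! ### Transfer to the conjugate immersion. -/

theorem mainTheorem5 (h : ℂ → ℂ) (f : ℂ → ℝ)
    (hX : IsConformalMinimalImmersion h f) (hgraph : IsEntireGraph h f)
    (hint : ∀ γ : ℝ → ℂ, IsDivergentPath γ → HasFiniteLength γ →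
      IntegrableOn (fun t => ‖hopf h (γ t)‖ ^ (1 / 2 : ℝ) * ‖deriv γ t‖) (Ico 0 1))
    (h' : ℂ → ℂ) (f' : ℂ → ℝ)
    (hX' : IsConformalMinimalImmersion h' f') (hconj : IsConjugate h f h' f') :
    IsEntireGraph h' f' := by
  obtain ⟨r, hr, hφ⟩ := hX.norm_hopf_le hint
  obtain ⟨c, hc, hcw⟩ := hX.exists_expanding_factor hgraph hr hφ
  have hexp : ∀ w ∈ disk, ∀ v,
      c * hypFactor w * ‖v‖ ≤ hypFactor (h' w) * ‖fderiv ℝ h' w v‖ := by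
    intro w hw v
    have h1 := hcw w hw
    -- Conjugacy enters only here: the lower bound on the smaller singular value passes from h to
    -- h'.
    rw [← hX.conjugate_norm_sub hX' hconj hw] at h1
    have h2 := norm_sub_mul_le_norm_fderiv h' w v
    have h3 := (hypFactor_pos (hX'.mapsTo hw)).le
    calc _ ≤ hypFactor (h' w) * |‖wirt h' w‖ - ‖wirtBar h' w‖| * ‖v‖ := by gcongr
      _ = hypFactor (h' w) * (|‖wirt h' w‖ - ‖wirtBar h' w‖| * ‖v‖) := mul_assoc _ _ _
      _ ≤ _ := by gcongr
  have hinj : ∀ w ∈ disk, Function.Injective (fderiv ℝ h' w) := by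
    intro w hw
    rw [injective_iff_map_eq_zero]
    intro v hv
    have h1 := hexp w hw v
    rw [hv, norm_zero, mul_zero] at h1
    have h2 : 0 < c * hypFactor w := mul_pos hc (hypFactor_pos hw)
    exact norm_le_zero_iff.1 (nonpos_of_mul_nonpos_right h1 h2)
  exact hX'.isEntireGraph_of_bijOn (bijOn_disk_of_expanding hc
    (fun w hw => hX'.contDiffAt_fst hw) hX'.mapsTo hinj hexp) hinj
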